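/- **Conventions.** A premaniplex of rank $N$ is a finite connected graph with edges colored $0,\dots,N-1$, in which every vertex (flag) $v$ is incident to exactly one edge of each color (possibly a semi-edge, which has a single, self-inverse dart) and alternating paths of length 4 in two non-consecutive colors are closed; $v^i$ is the other end of the edge of color $i$ at $v$ ($v^i=v$ for a semi-edge). All permutations act on the right, and $r_i$ is the permutation $v\mapsto v^i$. An $i$-face is a connected component of the graph obtained by deleting the edges of color $i$; $\mathrm{Fac}(\mathcal M)$ is the set of facets, i.e. $(N-1)$-faces, and $\overline f\subseteq \mathrm{Fac}(\mathcal M)$ is the set of facets meeting a face $f$. $\Gamma(\mathcal M)$ is the group of color-preserving automorphisms. For $\mathcal M$ of rank $N$, $\hat 2^{\mathcal M}$ has flags $(\Phi,x)$ with $\Phi$ a flag of $\mathcal M$ and $x\in\mathbb Z_2^{\mathrm{Fac}(\mathcal M)}$, and adjacencies $(\Phi,x)^i=(\Phi^i,x)$ for $i<N$, $(\Phi,x)^N=(\Phi,x+\chi_{\mathrm{Fac}(\Phi)})$. Let $\mathcal M_2$ be the flag graph of the square and $\mathcal M_{j+1}=\hat 2^{\mathcal M_j}$; these are regular (their automorphism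 groups are transitive on flags). Let $S_3\subseteq \mathrm{Fac}(\mathcal M_3)$ be a set that is not invariant under any non-trivial automorphism of $\mathcal M_3$ and is not contained in $\overline u\cup\overline v$ for any two $0$-faces $u,v$ of $\mathcal M_3$; for $j\ge3$ let $S_{j+1}=\{(F_j,\chi_F):F\in S_j\}\cup\{(F_j,0)\}$, where $(F_j,x)$ denotes the facet of $\mathcal M_{j+1}$ consisting of the flags with vector $x$. **Setting.** Let $n\ge 4$, let $I\subset\{0,\dots,n\}$ with $0,n\notin I$, and let $\mathcal X=2^{n+1}_I$ be the premaniplex of rank $n+1$ with two vertices, one white and one black, whose edges of color $i$ are semi-edges if $i\in I$ and a link if $i\notin I$. Let $p$ be a covering from $\mathcal M_n$ to $\mathcal X$ with its edge of color $n$ deleted (a map of vertices preserving $i$-adjacency for $i<n$), and let $(\mathcal M_n)_w$ be the set of flags over the white vertex. Fix a base flag $\phi$ of $\mathcal M_{n-1}$. For $x\in\mathbb Z_2^{\mathrm{Fac}(\mathcal M_{n-1})}$ let the base flag of the facet of $\mathcal M_n$ with vector $x$ be $(\phi\gamma,x)$ if $\operatorname{supp}(x)=S_{n-1}\gamma$ for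 some (necessarily unique) $\gamma\in\Gamma(\mathcal M_{n-1})$, and $(\phi,x)$ if there is no such $\gamma$. Let $\tilde\rho_0$ be the flag permutation of $\mathcal M_n$ that acts on each facet as the automorphism of that facet mapping its base flag to the $0$-adjacent flag. Let $\ell\ge1$. Permutations of flags preserving $(\mathcal M_n)_w$ act on $(\mathcal M_n)_w\times\mathbb Z_{2\ell}$ through the first coordinate. Let $s$ be an involution of $(\mathcal M_n)_w\times\mathbb Z_{2\ell}$ which changes only the $\mathbb Z_{2\ell}$-coordinate and commutes with $\tilde\rho_0r_0$. The voltage assignment $\xi'$ on $\mathcal X$, with values in the permutations of $(\mathcal M_n)_w\times\mathbb Z_{2\ell}$, is given on a dart $d$ by $$\xi'(d)=\begin{cases}1&d\text{ has color }0,\\ r_i& d\text{ is a semi-edge of color } i\in[1,n-1]\text{ at the white vertex},\\ r_0r_ir_0& d\text{ is a semi-edge of color } i\in[1,n-1]\text{ at the black vertex},\\ r_0r_i& d\text{ goes from white to black and has color } i\in[1,n-1],\\ r_ir_0& d\text{ goes from black to white and has color } i\in[1,n-1],\\ \tilde\rho_0r_0s& d\text{ has color } n,\end{cases}$$ and on (homotopy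 classes of) paths by $\xi'(d_1d_2\cdots d_q)=\xi'(d_q)\cdots\xi'(d_2)\xi'(d_1)$. For vertices $a,b$ of $\mathcal X$ let $\Pi^{a,b}_{[k,m]}$ be the set of homotopy classes of paths in $\mathcal X$ from $a$ to $b$ that only use darts with colors in $[k,m]=\{i:k\le i\le m\}$. **Statement.** For all $k>1$, all $m\in\{0,\dots,n\}$ and all vertices $a,b$ of $\mathcal X$, $$\xi'(\Pi^{a,b}_{[0,m]})\cap\xi'(\Pi^{a,b}_{[k,n]})=\xi'(\Pi^{a,b}_{[k,m]}).$$ -/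

import Mathlib

open Equiv MulOpposite

/-- A finite premaniplex of rank `N`: a connected graph in which every vertex `v` is incident to
exactly one edge of each color `i < N`, and in which alternating paths of length 4 in two
non-consecutive colors are closed.  The edge of color `i` at `v` joins `v` to `adj i v`; it is a
semi-edge when `adj i v = v` and a link otherwise. -/
structure Premaniplex (N : ℕ) where
  V : Type
  finite : Finite V
  adj : Fin N → V → V
  adj_adj : ∀ i v, adj i (adj i v) = v
  adj_comm : ∀ i j : Fin N, (i : ℕ) + 1 < j → ∀ v, adj i (adj j v) = adj j (adj i v)
  connected : ∀ u v, Relation.ReflTransGen (fun a b => ∃ i, b = adj i a) u v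

namespace Premaniplex

section Basic

variable {N : ℕ} (K : Premaniplex N)

/-- The permutation mapping each flag to its `i`-adjacent flag.  Groups of flag permutations act
on the right, so they are opposites of Mathlib's permutation groups: in `g * h` the permutation
`g` is applied first. -/
def r (i : Fin N) : (Perm K.V)ᵐᵒᵖ :=
  op (Function.Involutive.toPerm (K.adj i) (K.adj_adj i))

/-- Two flags lie in the same connected component after the edges of color `i` are removed. -/
def SameFace (i : Fin N) : K.V → K.V → Prop :=
  Relation.ReflTransGen (fun a b => ∃ j, j ≠ i ∧ b = K.adj j a)

theorem sameFace_symm (i : Fin N) {u v : K.V} (h : K.SameFace i u v) : K.SameFace i v u := by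
  induction h with
  | refl => exact Relation.ReflTransGen.refl
  | tail _ hbc ih =>
    obtain ⟨j, hj, rfl⟩ := hbc
    exact Relation.ReflTransGen.head ⟨j, hj, (K.adj_adj j _).symm⟩ ih

/-- The partition of the flags into `i`-faces. -/
def faceSetoid (i : Fin N) : Setoid K.V where
  r := K.SameFace i
  iseqv := ⟨fun _ => Relation.ReflTransGen.refl, K.sameFace_symm i, Relation.ReflTransGen.trans⟩

/-- The `i`-faces: connected components of the graph without the edges of color `i`. -/
def Face (i : Fin N) : Type := Quotient (K.faceSetoid i)

/-- The `i`-face of a flag. -/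
def face (i : Fin N) (v : K.V) : K.Face i := Quotient.mk (K.faceSetoid i) v

theorem face_adj {i j : Fin N} (h : j ≠ i) (v : K.V) : K.face i (K.adj j v) = K.face i v :=
  Quotient.sound (s := K.faceSetoid i)
    (Relation.ReflTransGen.single ⟨j, h, (K.adj_adj j v).symm⟩)

/-- The automorphism group: flag permutations preserving all colored adjacencies. -/
def Aut : Subgroup (Perm K.V) where
  carrier := {σ | ∀ i v, σ (K.adj i v) = K.adj i (σ v)}
  one_mem' := by intro i v; rfl
  mul_mem' := by
    intro a b ha hb i v
    simp only [Set.mem_ofPred_eq] at ha hb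
    simp [Perm.mul_apply, ha, hb]
  inv_mem' := by
    intro a ha i v
    simp only [Set.mem_ofPred_eq] at ha
    rw [Perm.inv_eq_iff_eq, ha]
    simp

theorem Aut.map_adj (σ : K.Aut) (i : Fin N) (v : K.V) :
    (σ : Perm K.V) (K.adj i v) = K.adj i ((σ : Perm K.V) v) := σ.2 i v

/-- A premaniplex is regular if its automorphism group is transitive on its flags. -/
def IsRegular : Prop := ∀ u v : K.V, ∃ σ : K.Aut, (σ : Perm K.V) u = v

/-- Automorphisms that agree on one flag agree everywhere. -/
theorem Aut.eq_of_apply_eq {σ τ : K.Aut} (u : K.V)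
    (h : (σ : Perm K.V) u = (τ : Perm K.V) u) : σ = τ := by
  apply Subtype.ext
  ext v
  have hc := K.connected u v
  induction hc with
  | refl => exact h
  | tail _ hbc ih =>
    obtain ⟨i, rfl⟩ := hbc
    rw [Aut.map_adj, Aut.map_adj, ih]

/-- The action of an automorphism on `i`-faces. -/
def faceMap (i : Fin N) (σ : K.Aut) : K.Face i → K.Face i :=
  Quotient.map' (σ : Perm K.V) (by
    intro u v h
    change K.SameFace i _ _
    change K.SameFace i u v at h
    induction h with
    | refl => exact Relation.ReflTransGen.refl
    | tail _ hbc ih =>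
      obtain ⟨j, hj, rfl⟩ := hbc
      exact ih.tail ⟨j, hj, σ.2 j _⟩)

theorem faceMap_face (i : Fin N) (σ : K.Aut) (v : K.V) :
    K.faceMap i σ (K.face i v) = K.face i ((σ : Perm K.V) v) := rfl

theorem faceMap_inv (i : Fin N) (σ : K.Aut) (F : K.Face i) :
    K.faceMap i σ⁻¹ (K.faceMap i σ F) = F := by
  induction F using Quotient.inductionOn
  rename_i v
  change K.face i (((σ⁻¹ : K.Aut) : Perm K.V) ((σ : Perm K.V) v)) = K.face i v
  simp

theorem faceMap_inv' (i : Fin N) (σ : K.Aut) (F : K.Face i) :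
    K.faceMap i σ (K.faceMap i σ⁻¹ F) = F := by
  simpa using K.faceMap_inv i σ⁻¹ F

end Basic

section Hat

variable {n : ℕ} (K : Premaniplex (n + 1))

/-- The facets of a premaniplex of rank `n + 1` are its `n`-faces. -/
abbrev Facet : Type := K.Face (Fin.last n)

/-- The facet of a flag. -/
abbrev facet (v : K.V) : K.Facet := K.face (Fin.last n) v

/-- The closure of a face: the set of facets incident to it, i.e. having a flag in common
with it. -/
def closure {i : Fin (n + 1)} (f : K.Face i) : Set K.Facet :=
  {F | ∃ v, K.face i v = f ∧ K.facet v = F}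

open Classical in
/-- The characteristic vector of a facet. -/
noncomputable def chi (F : K.Facet) : K.Facet → ZMod 2 := Pi.single F 1

/-- The adjacencies of the premaniplex `2̂^K`. -/
noncomputable def hatAdj (i : Fin (n + 2)) (v : K.V × (K.Facet → ZMod 2)) :
    K.V × (K.Facet → ZMod 2) :=
  if h : (i : ℕ) < n + 1 then (K.adj ⟨i, h⟩ v.1, v.2) else (v.1, v.2 + K.chi (K.facet v.1))

theorem hatAdj_castSucc (i : Fin (n + 1)) (v : K.V × (K.Facet → ZMod 2)) :
    K.hatAdj i.castSucc v = (K.adj i v.1, v.2) :=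
  dif_pos i.isLt

theorem hatAdj_last (v : K.V × (K.Facet → ZMod 2)) :
    K.hatAdj (Fin.last (n + 1)) v = (v.1, v.2 + K.chi (K.facet v.1)) :=
  dif_neg (by simp)

theorem hat_reach_fst (x : K.Facet → ZMod 2) (u v : K.V) :
    Relation.ReflTransGen (fun a b => ∃ i, b = K.hatAdj i a) (u, x) (v, x) := by
  have hc := K.connected u v
  induction hc with
  | refl => exact Relation.ReflTransGen.refl
  | tail _ hbc ih =>
    obtain ⟨i, rfl⟩ := hbc
    exact ih.tail ⟨i.castSucc, by rw [hatAdj_castSucc]⟩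

theorem hat_reach_chi (u : K.V) (x : K.Facet → ZMod 2) (F : K.Facet) :
    Relation.ReflTransGen (fun a b => ∃ i, b = K.hatAdj i a) (u, x) (u, x + K.chi F) := by
  induction F using Quotient.inductionOn
  rename_i v
  exact ((K.hat_reach_fst x u v).tail ⟨Fin.last _, by rw [hatAdj_last]; rfl⟩).trans
    (K.hat_reach_fst _ v u)

theorem hat_reach_snd (u : K.V) (x y : K.Facet → ZMod 2) :
    Relation.ReflTransGen (fun a b => ∃ i, b = K.hatAdj i a) (u, x) (u, y) := by
  classical
  have := K.finite
  have : Finite K.Facet := Quotient.finite _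
  have := Fintype.ofFinite K.Facet
  have key : ∀ (z : K.Facet → ZMod 2) (T : Finset K.Facet),
      Relation.ReflTransGen (fun a b => ∃ i, b = K.hatAdj i a) (u, x)
        (u, x + ∑ F ∈ T, (Pi.single F (z F) : K.Facet → ZMod 2)) := by
    intro z T
    induction T using Finset.induction_on with
    | empty => simp only [Finset.sum_empty, add_zero]; exact Relation.ReflTransGen.refl
    | insert F T hF ih =>
      rw [Finset.sum_insert hF, add_comm (Pi.single F (z F) : K.Facet → ZMod 2), ← add_assoc]
      have hz : z F = 0 ∨ z F = 1 := by
        generalize z F = c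
        revert c
        decide
      rcases hz with hz | hz
      · simpa [hz] using ih
      · rw [hz]
        refine ih.trans ?_
        exact K.hat_reach_chi u _ F
  have h := key (y - x) Finset.univ
  rw [Finset.univ_sum_single] at h
  simpa using h

/-- The premaniplex `2̂^K`, of rank one more than `K`.  Its flags are the pairs `(Φ, x)` of a flag
of `K` and a vector in `ℤ₂^Fac(K)`; the adjacencies of the old colors act on `Φ`, and the
adjacency of the new color adds to `x` the characteristic vector of the facet of `Φ`. -/
@[reducible] noncomputable def hat : Premaniplex (n + 2) where
  V := K.V × (K.Facet → ZMod 2)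
  finite := by
    have := K.finite
    have : Finite K.Facet := Quotient.finite _
    infer_instance
  adj := K.hatAdj
  adj_adj := by
    intro i v
    induction i using Fin.lastCases with
    | last =>
      simp only [hatAdj_last, add_assoc]
      ext1
      · rfl
      · funext F
        have : ∀ a b : ZMod 2, a + (b + b) = a := by decide
        simp [this]
    | cast i => simp [hatAdj_castSucc, K.adj_adj]
  adj_comm := by
    intro i j hij v
    induction i using Fin.lastCases with
    | last => have := j.isLt; simp at hij; omega
    | cast i =>
      induction j using Fin.lastCases with
      | last =>
        have hi : i ≠ Fin.last n := by rintro rfl; simp at hij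
        simp only [hatAdj_last, hatAdj_castSucc]
        rw [facet, facet, K.face_adj hi]
      | cast j =>
        simp only [hatAdj_castSucc]
        rw [K.adj_comm i j (by simpa using hij)]
  connected := by
    rintro ⟨u, x⟩ ⟨v, y⟩
    exact (K.hat_reach_fst x u v).trans (K.hat_reach_snd v x y)

theorem hat_isRegular (hK : K.IsRegular) : K.hat.IsRegular := by
  classical
  rintro ⟨u, x⟩ ⟨v, y⟩
  obtain ⟨σ, hσ⟩ := hK u v
  have hchi : ∀ w : K.V, (fun F => K.chi (K.facet w) (K.faceMap _ σ⁻¹ F))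
      = K.chi (K.facet ((σ : Perm K.V) w)) := by
    intro w
    funext F
    have hiff : K.faceMap _ σ⁻¹ F = K.facet w ↔ F = K.facet ((σ : Perm K.V) w) := by
      constructor
      · intro h
        rw [facet, ← K.faceMap_face, ← facet, ← h, K.faceMap_inv']
      · rintro rfl
        rw [facet, ← K.faceMap_face, K.faceMap_inv]
    simp only [chi, Pi.single_apply, hiff]
  let f : Perm K.hat.V :=
    { toFun := fun w => ((σ : Perm K.V) w.1,
        fun F => w.2 (K.faceMap _ σ⁻¹ F) + (y F - x (K.faceMap _ σ⁻¹ F)))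
      invFun := fun w => (((σ⁻¹ : K.Aut) : Perm K.V) w.1,
        fun F => w.2 (K.faceMap _ σ F) - (y (K.faceMap _ σ F) - x F))
      left_inv := by
        rintro ⟨w, z⟩
        ext1
        · simp
        · funext F; simp [K.faceMap_inv]
      right_inv := by
        rintro ⟨w, z⟩
        ext1
        · simp
        · funext F; simp [K.faceMap_inv'] }
  refine ⟨⟨f, ?_⟩, ?_⟩
  · rintro i ⟨w, z⟩
    change f (K.hatAdj i (w, z)) = K.hatAdj i (f (w, z))
    induction i using Fin.lastCases with
    | last =>
      rw [hatAdj_last, hatAdj_last]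
      ext1
      · rfl
      · funext F
        have := congrFun (hchi w) F
        simp only [f, Equiv.coe_fn_mk, Pi.add_apply, ← this]
        ring
    | cast i =>
      rw [hatAdj_castSucc, hatAdj_castSucc]
      ext1
      · exact σ.2 i w
      · rfl
  · change f (u, x) = (v, y)
    ext1
    · exact hσ
    · funext F; simp [f]

/-- For a set `S` of facets of `K`, the set `Ŝ = {(F_n, χ_F) | F ∈ S} ∪ {(F_n, 0)}` of facets of
`2̂^K`, where `(F_n, x)` is the facet consisting of all the flags `(Φ, x)`. -/
def hatSet (S : Set K.Facet) : Set K.hat.Facet :=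
  {G | ∃ (v : K.V) (x : K.Facet → ZMod 2),
    G = K.hat.facet (v, x) ∧ (x = 0 ∨ ∃ F ∈ S, x = K.chi F)}

end Hat

section Family

/-- The adjacencies in the flag graph of the square with vertices `j ∈ ℤ₄` and edges
`{j, j + 1}`.  The flag `(j, false)` consists of the vertex `j` and the edge `{j, j + 1}`, and the
flag `(j, true)` of the vertex `j` and the edge `{j - 1, j}`. -/
def squareAdj (i : Fin 2) (v : ZMod 4 × Bool) : ZMod 4 × Bool :=
  if i = 0 then (if v.2 then (v.1 - 1, false) else (v.1 + 1, true)) else (v.1, !v.2)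

/-- The rotations and reflections of the square. -/
def squareSym (c : ZMod 4) (e : Bool) (v : ZMod 4 × Bool) : ZMod 4 × Bool :=
  if e then (c - v.1, !v.2) else (c + v.1, v.2)

/-- The flag graph of the square. -/
@[reducible] def square : Premaniplex 2 where
  V := ZMod 4 × Bool
  finite := inferInstance
  adj := squareAdj
  adj_adj := by decide
  adj_comm := by decide
  connected := by
    have step : ∀ (j : ZMod 4), Relation.ReflTransGen (fun a b => ∃ i, b = squareAdj i a)
        (j, false) (j + 1, false) := fun j =>
      (Relation.ReflTransGen.single ⟨0, rfl⟩).tail ⟨1, rfl⟩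
    have steps : ∀ (j : ZMod 4) (c : ℕ), Relation.ReflTransGen
        (fun a b => ∃ i, b = squareAdj i a) (j, false) (j + c, false) := by
      intro j c
      induction c with
      | zero => simp only [Nat.cast_zero, add_zero]; exact Relation.ReflTransGen.refl
      | succ c ih =>
        rw [Nat.cast_succ, ← add_assoc]
        exact ih.trans (step _)
    have all : ∀ j k : ZMod 4, Relation.ReflTransGen
        (fun a b => ∃ i, b = squareAdj i a) (j, false) (k, false) := by
      intro j k
      have h := steps j (k - j).val
      rw [ZMod.natCast_zmod_val] at h
      simpa using h
    have toF : ∀ v : ZMod 4 × Bool, Relation.ReflTransGen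
        (fun a b => ∃ i, b = squareAdj i a) v (v.1, false) := by
      rintro ⟨j, _ | _⟩
      · exact Relation.ReflTransGen.refl
      · exact Relation.ReflTransGen.single ⟨1, rfl⟩
    have fromF : ∀ v : ZMod 4 × Bool, Relation.ReflTransGen
        (fun a b => ∃ i, b = squareAdj i a) (v.1, false) v := by
      rintro ⟨j, _ | _⟩
      · exact Relation.ReflTransGen.refl
      · exact Relation.ReflTransGen.single ⟨1, rfl⟩
    intro u v
    exact ((toF u).trans (all _ _)).trans (fromF v)

theorem square_isRegular : square.IsRegular := by
  have hinj : ∀ c e, Function.Injective (squareSym c e) := by decide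
  have haut : ∀ c e i v, squareSym c e (squareAdj i v) = squareAdj i (squareSym c e v) := by
    decide
  have htrans : ∀ u v : ZMod 4 × Bool, ∃ c e, squareSym c e u = v := by decide
  intro u v
  obtain ⟨c, e, h⟩ := htrans u v
  exact ⟨⟨Equiv.ofBijective (α := ZMod 4 × Bool) (squareSym c e)
    (Finite.injective_iff_bijective.mp (hinj c e)), haut c e⟩, h⟩

/-- The family of regular maniplexes `M_n`, `n ≥ 2`: `fam j` is `M_(j+2)`, so that `M_2` is the
flag graph of the square and `M_(n+1)` is `2̂^(M_n)`. -/
noncomputable def fam : (j : ℕ) → Premaniplex (j + 2)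
  | 0 => square
  | j + 1 => (fam j).hat

theorem fam_isRegular : ∀ j, (fam j).IsRegular
  | 0 => square_isRegular
  | j + 1 => (fam j).hat_isRegular (fam_isRegular j)

/-- The sets of facets `S_n ⊆ Fac(M_n)`, `n ≥ 3`, obtained from `S_3` by the recursion
`S_(n+1) = Ŝ_n`: `famSet S₃ j` is `S_(j+3)`. -/
def famSet (S₃ : Set (fam 1).Facet) : (j : ℕ) → Set (fam (j + 1)).Facet
  | 0 => S₃
  | j + 1 => (fam (j + 1)).hatSet (famSet S₃ j)

end Family

section Paths

variable {N : ℕ} (X : Premaniplex N)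

/-- The dart of color `color` starting at `src`.  A semi-edge has a single dart. -/
structure Dart where
  src : X.V
  color : Fin N

variable {X}

/-- The endpoint of a dart. -/
def Dart.tgt (d : X.Dart) : X.V := X.adj d.color d.src

/-- The inverse dart. -/
def Dart.inv (d : X.Dart) : X.Dart := ⟨d.tgt, d.color⟩

/-- The sequence of darts is a path from `a` to `b`. -/
def IsPath (b : X.V) : X.V → List X.Dart → Prop
  | a, [] => a = b
  | a, d :: W => d.src = a ∧ IsPath b d.tgt W

variable (X)

/-- The paths from `a` to `b`. -/
def Path (a b : X.V) : Type := {W : List X.Dart // IsPath b a W}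

variable {X}

/-- Elementary homotopy: insertion of two consecutive inverse darts. -/
def Insertion {a b : X.V} (W W' : X.Path a b) : Prop :=
  ∃ (W₁ W₂ : List X.Dart) (d : X.Dart), W.1 = W₁ ++ W₂ ∧ W'.1 = W₁ ++ d :: d.inv :: W₂

variable (X)

/-- The homotopy classes of paths from `a` to `b` (the elements of the fundamental groupoid from
`a` to `b`): homotopy is the equivalence relation generated by insertions. -/
def HomotopyClass (a b : X.V) : Type := Quot (Insertion (X := X) (a := a) (b := b))

/-- `Π^{a,b}_J(X)`: the (homotopy classes of) paths from `a` to `b` that only use darts with colors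
in `J`. -/
def pathsWithColors (J : Set (Fin N)) (a b : X.V) : Set (X.HomotopyClass a b) :=
  {w | ∃ W : X.Path a b, (∀ d ∈ W.1, d.color ∈ J) ∧ Quot.mk _ W = w}

/-- A voltage assignment, given on darts in such a way that inverse darts have inverse
voltages. -/
structure Voltage (Γ : Type) [Group Γ] where
  val : X.Dart → Γ
  val_inv : ∀ d, val d.inv = (val d)⁻¹

variable {X}

/-- The voltage of `d₁ d₂ ⋯ d_k` is `ξ(d_k) ⋯ ξ(d₂) ξ(d₁)`. -/
def Voltage.listVoltage {Γ : Type} [Group Γ] (ξ : X.Voltage Γ) : List X.Dart → Γ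
  | [] => 1
  | d :: W => ξ.listVoltage W * ξ.val d

theorem Voltage.listVoltage_append {Γ : Type} [Group Γ] (ξ : X.Voltage Γ)
    (W₁ W₂ : List X.Dart) :
    ξ.listVoltage (W₁ ++ W₂) = ξ.listVoltage W₂ * ξ.listVoltage W₁ := by
  induction W₁ with
  | nil => simp [listVoltage]
  | cons d W ih => simp [listVoltage, ih, mul_assoc]

/-- The voltage of a homotopy class of paths. -/
def Voltage.onPaths {Γ : Type} [Group Γ] (ξ : X.Voltage Γ) {a b : X.V} :
    X.HomotopyClass a b → Γ :=
  Quot.lift (fun W => ξ.listVoltage W.1) (by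
    rintro W W' ⟨W₁, W₂, d, h, h'⟩
    simp only [h, h', ξ.listVoltage_append, listVoltage, ξ.val_inv]
    group)

end Paths

/-- The set `[k, m]` of colors; it is empty if `k > m`. -/
def colorInterval (N k m : ℕ) : Set (Fin N) := {i | k ≤ (i : ℕ) ∧ (i : ℕ) ≤ m}

section TwoVertices

open Classical in
/-- The premaniplex `2^N_I`, whose two vertices are white (`true`) and black (`false`): the edges
with colors in `I` are semi-edges and the other ones are links. -/
@[reducible] noncomputable def two {N : ℕ} (I : Set (Fin N)) (hI : I ≠ Set.univ) : Premaniplex N where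
  V := Bool
  finite := inferInstance
  adj := fun i v => if i ∈ I then v else !v
  adj_adj := by intro i v; by_cases h : i ∈ I <;> simp [h]
  adj_comm := by
    intro i j _ v
    by_cases h : i ∈ I <;> by_cases h' : j ∈ I <;> simp [h, h']
  connected := by
    obtain ⟨i, hi⟩ := (Set.ne_univ_iff_exists_notMem I).mp hI
    intro u v
    by_cases h : u = v
    · subst h; exact Relation.ReflTransGen.refl
    · refine Relation.ReflTransGen.single ⟨i, ?_⟩
      rw [if_neg hi]
      cases u <;> cases v <;> simp_all

end TwoVertices

section Construction

/-!
The voltage assignments on `X = 2^{n+1}_I`, for `n = r + 2`, with flag permutations of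
`M = 2̂^K`, where `K` is a regular maniplex of rank `n - 1`.
-/

variable {r : ℕ} (K : Premaniplex (r + 1)) (hK : K.IsRegular)
  (S : Set K.Facet) (φ : K.V)

/-- The automorphism of the regular maniplex `K` that maps `u` to `v`. -/
noncomputable def autOf (u v : K.V) : K.Aut := (hK u v).choose

theorem autOf_apply (u v : K.V) : (K.autOf hK u v : Perm K.V) u = v := (hK u v).choose_spec

open Classical in
/-- The base flag of the facet `(F, x)` of `2̂^K` is `(baseFlag x, x)`, and its base edge is the
edge of this flag.  The base flag of the facet with vector `0` is `(φ, 0)`, with an edge `(e, 0)`.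
The base edge is `(e γ, x)` if the support of `x` is the copy `S γ` of `S` by the automorphism
`γ` of `K`, and it is `(e, x)` if the support of `x` is not a copy of `S`. -/
noncomputable def baseFlag (x : K.Facet → ZMod 2) : K.V :=
  if h : ∃ γ : K.Aut, Function.support x = K.faceMap (Fin.last r) γ '' S
  then (h.choose : Perm K.V) φ else φ

/-- The reflection of the facet with vector `x`: the automorphism that maps its base flag to the
`0`-adjacent flag, that is, the one that fixes all the faces of the base flag but its `0`-face. -/
noncomputable def facetReflection (x : K.Facet → ZMod 2) : K.Aut :=
  K.autOf hK (K.baseFlag S φ x) (K.adj 0 (K.baseFlag S φ x))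

theorem facetReflection_sq (x : K.Facet → ZMod 2) :
    K.facetReflection hK S φ x * K.facetReflection hK S φ x = 1 := by
  apply Aut.eq_of_apply_eq K (K.baseFlag S φ x)
  have h := K.autOf_apply hK (K.baseFlag S φ x) (K.adj 0 (K.baseFlag S φ x))
  simp only [Subgroup.coe_mul, Perm.mul_apply, facetReflection, Subgroup.coe_one, Perm.one_apply]
  rw [h, Aut.map_adj, h, K.adj_adj]

theorem facetReflection_apply_apply (x : K.Facet → ZMod 2) (v : K.V) :
    (K.facetReflection hK S φ x : Perm K.V) ((K.facetReflection hK S φ x : Perm K.V) v) = v := by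
  have h := congrArg (fun σ : K.Aut => (σ : Perm K.V) v) (K.facetReflection_sq hK S φ x)
  simpa using h

/-- The flag permutation `ρ̃₀` of `2̂^K`, which acts on each facet as its reflection. -/
noncomputable def rhoTilde : (Perm K.hat.V)ᵐᵒᵖ :=
  op (Function.Involutive.toPerm
    (fun v : K.hat.V => ((K.facetReflection hK S φ v.2 : Perm K.V) v.1, v.2))
    (fun v => Prod.ext (K.facetReflection_apply_apply hK S φ v.2 v.1) rfl))

/-- The permutation `y_n = ρ̃₀ r₀`. -/
noncomputable def yPerm : (Perm K.hat.V)ᵐᵒᵖ := K.rhoTilde hK S φ * K.hat.r 0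

theorem r_mul_self {N : ℕ} (M : Premaniplex N) (i : Fin N) : M.r i * M.r i = 1 := by
  apply MulOpposite.unop_injective
  ext v
  exact M.adj_adj i v

theorem r_inv {N : ℕ} (M : Premaniplex N) (i : Fin N) : (M.r i)⁻¹ = M.r i :=
  inv_eq_of_mul_eq_one_left (M.r_mul_self i)

theorem rhoTilde_mul_self : K.rhoTilde hK S φ * K.rhoTilde hK S φ = 1 := by
  apply MulOpposite.unop_injective
  apply Equiv.ext
  intro v
  exact Prod.ext (K.facetReflection_apply_apply hK S φ v.2 v.1) rfl

theorem rhoTilde_comm : K.rhoTilde hK S φ * K.hat.r 0 = K.hat.r 0 * K.rhoTilde hK S φ := by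
  apply MulOpposite.unop_injective
  apply Equiv.ext
  rintro ⟨v, x⟩
  change K.hatAdj (Fin.castSucc 0) _ = ((K.facetReflection hK S φ (K.hatAdj (Fin.castSucc 0)
    (v, x)).2 : Perm K.V) (K.hatAdj (Fin.castSucc 0) (v, x)).1, (K.hatAdj (Fin.castSucc 0)
    (v, x)).2)
  rw [hatAdj_castSucc, hatAdj_castSucc]
  exact Prod.ext (Aut.map_adj K _ _ _).symm rfl

theorem yPerm_mul_self : K.yPerm hK S φ * K.yPerm hK S φ = 1 := by
  have h : K.yPerm hK S φ * K.yPerm hK S φ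
      = (K.rhoTilde hK S φ * K.rhoTilde hK S φ) * (K.hat.r 0 * K.hat.r 0) := by
    unfold yPerm
    rw [mul_assoc, ← mul_assoc (K.hat.r 0), ← rhoTilde_comm]
    simp only [mul_assoc]
  rw [h, rhoTilde_mul_self, r_mul_self, mul_one]

variable (I : Set (Fin (r + 3))) (hI : I ≠ Set.univ)

open Classical in
/-- The voltages `ξ(d)` of the darts of `2^{n+1}_I` in the flag permutations of `2̂^K`. -/
noncomputable def xiVal (d : (two I hI).Dart) : (Perm K.hat.V)ᵐᵒᵖ :=
  if d.color = 0 then 1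
  else if h : (d.color : ℕ) < r + 2 then
    if d.tgt = d.src then
      if d.src = true then K.hat.r ⟨d.color, h⟩
      else K.hat.r 0 * K.hat.r ⟨d.color, h⟩ * K.hat.r 0
    else
      if d.src = true then K.hat.r 0 * K.hat.r ⟨d.color, h⟩
      else K.hat.r ⟨d.color, h⟩ * K.hat.r 0
  else K.yPerm hK S φ

theorem xiVal_inv (d : (two I hI).Dart) :
    K.xiVal hK S φ I hI d.inv = (K.xiVal hK S φ I hI d)⁻¹ := by
  classical
  obtain ⟨v, i⟩ := d
  have hy : (K.yPerm hK S φ)⁻¹ = K.yPerm hK S φ :=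
    inv_eq_of_mul_eq_one_left (K.yPerm_mul_self hK S φ)
  have aux₁ : ∀ {a b : (Perm K.hat.V)ᵐᵒᵖ}, a⁻¹ = a → b⁻¹ = b →
      a * b * a = (a * b * a)⁻¹ := by
    intro a b ha hb
    rw [mul_inv_rev, mul_inv_rev, ha, hb, mul_assoc]
  have aux₂ : ∀ {a b : (Perm K.hat.V)ᵐᵒᵖ}, a⁻¹ = a → b⁻¹ = b → b * a = (a * b)⁻¹ := by
    intro a b ha hb
    rw [mul_inv_rev, ha, hb]
  change Bool at v
  by_cases h0 : i = 0
  · simp [xiVal, Dart.inv, h0]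
  by_cases hn : (i : ℕ) < r + 2
  · by_cases hi : i ∈ I
    · cases v
      · simpa [xiVal, Dart.inv, Dart.tgt, h0, hn, hi, -mul_inv_rev] using
          aux₁ (K.hat.r_inv 0) (K.hat.r_inv ⟨i, hn⟩)
      · simpa [xiVal, Dart.inv, Dart.tgt, h0, hn, hi, -mul_inv_rev] using
          (K.hat.r_inv ⟨i, hn⟩).symm
    · cases v
      · simpa [xiVal, Dart.inv, Dart.tgt, h0, hn, hi, -mul_inv_rev] using
          aux₂ (K.hat.r_inv ⟨i, hn⟩) (K.hat.r_inv 0)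
      · simpa [xiVal, Dart.inv, Dart.tgt, h0, hn, hi, -mul_inv_rev] using
          aux₂ (K.hat.r_inv 0) (K.hat.r_inv ⟨i, hn⟩)
  · simp [xiVal, Dart.inv, h0, hn, hy]

/-- `p` is a covering of the premaniplex obtained from `X` by deleting the edges of its last
color. -/
def IsCovering {n : ℕ} (M : Premaniplex n) (X : Premaniplex (n + 1)) (p : M.V → X.V) : Prop :=
  ∀ (i : Fin n) (v : M.V), p (M.adj i v) = X.adj i.castSucc (p v)

variable (p : K.hat.V → (two I hI).V)

/-- The white flags of `2̂^K`, i.e. the ones lying over the white vertex of `X`. -/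
def WhiteFlag : Type := {v : K.hat.V // p v = true}

variable {K I hI p}

/-- `g` preserves (`b = false`) or changes (`b = true`) the color of every flag. -/
def Shifts (p : K.hat.V → (two I hI).V) (b : Bool) (g : (Perm K.hat.V)ᵐᵒᵖ) : Prop :=
  ∀ v, (p (g.unop v) : Bool) = xor b (p v)

theorem Shifts.mul {b c : Bool} {g h : (Perm K.hat.V)ᵐᵒᵖ} (hg : Shifts p b g)
    (hh : Shifts p c h) : Shifts p (xor b c) (g * h) := by
  intro v
  have h1 := hh (g.unop v)
  rw [hg v] at h1
  change (p (h.unop (g.unop v)) : Bool) = _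
  rw [h1]
  change xor c (xor b (p v : Bool)) = xor (xor b c) (p v : Bool)
  cases b <;> cases c <;> simp

theorem Shifts.one : Shifts p false (1 : (Perm K.hat.V)ᵐᵒᵖ) := by
  intro v
  exact (Bool.false_xor _).symm

theorem shifts_r_of_mem (hp : IsCovering K.hat (two I hI) p) {i : Fin (r + 2)}
    (hi : i.castSucc ∈ I) : Shifts p false (K.hat.r i) := by
  intro v
  have h := hp i v
  have h' : (two I hI).adj i.castSucc (p v) = p v := if_pos hi
  exact (h.trans h').trans (Bool.false_xor _).symm

theorem shifts_r_of_notMem (hp : IsCovering K.hat (two I hI) p) {i : Fin (r + 2)}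
    (hi : i.castSucc ∉ I) : Shifts p true (K.hat.r i) := by
  intro v
  have h := hp i v
  have h' : (two I hI).adj i.castSucc (p v) = !(p v) := if_neg hi
  exact (h.trans h').trans (Bool.true_xor _).symm

theorem shifts_rhoTilde (hp : IsCovering K.hat (two I hI) p) (h0 : (0 : Fin (r + 3)) ∉ I) :
    Shifts p true (K.rhoTilde hK S φ) := by
  rintro ⟨v, x⟩
  set ρ := K.facetReflection hK S φ x with hρ
  have hadj : ∀ (i : Fin (r + 1)) (w : K.V),
      p (K.adj i w, x) = (two I hI).adj i.castSucc.castSucc (p (w, x)) := by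
    intro i w
    rw [← hp i.castSucc (w, x)]
    change _ = p (K.hatAdj i.castSucc (w, x))
    rw [hatAdj_castSucc]
  have key : ∀ w : K.V, (p ((ρ : Perm K.V) w, x) : Bool) = !(p (w, x)) := by
    intro w
    have hc := K.connected (K.baseFlag S φ x) w
    induction hc with
    | refl =>
      have h1 : (ρ : Perm K.V) (K.baseFlag S φ x) = K.adj 0 (K.baseFlag S φ x) :=
        K.autOf_apply hK _ _
      rw [h1, hadj]
      simp [two, h0]
    | tail _ hbc ih =>
      obtain ⟨i, rfl⟩ := hbc
      rw [Aut.map_adj, hadj, hadj, ih]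
      by_cases h : i.castSucc.castSucc ∈ I <;> simp [two, h]
  exact (key v).trans (Bool.true_xor _).symm

theorem shifts_yPerm (hp : IsCovering K.hat (two I hI) p) (h0 : (0 : Fin (r + 3)) ∉ I) :
    Shifts p false (K.yPerm hK S φ) :=
  (shifts_rhoTilde hK S φ hp h0).mul (shifts_r_of_notMem hp (i := 0) h0)

theorem shifts_xiVal (hp : IsCovering K.hat (two I hI) p) (h0 : (0 : Fin (r + 3)) ∉ I)
    (d : (two I hI).Dart) : Shifts p false (K.xiVal hK S φ I hI d) := by
  classical
  obtain ⟨v, i⟩ := d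
  change Bool at v
  have hr0 : Shifts p true (K.hat.r 0) := shifts_r_of_notMem hp (i := 0) h0
  by_cases hi0 : i = 0
  · simpa [xiVal, hi0] using Shifts.one
  by_cases hn : (i : ℕ) < r + 2
  · by_cases hi : i ∈ I
    · have hri : Shifts p false (K.hat.r ⟨i, hn⟩) := shifts_r_of_mem hp hi
      cases v
      · simpa [xiVal, Dart.tgt, two, hi0, hn, hi] using (hr0.mul hri).mul hr0
      · simpa [xiVal, Dart.tgt, two, hi0, hn, hi] using hri
    · have hri : Shifts p true (K.hat.r ⟨i, hn⟩) := shifts_r_of_notMem hp hi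
      cases v
      · simpa [xiVal, Dart.tgt, two, hi0, hn, hi] using hri.mul hr0
      · simpa [xiVal, Dart.tgt, two, hi0, hn, hi] using hr0.mul hri
  · simpa [xiVal, hi0, hn] using shifts_yPerm hK S φ hp h0

variable (p) in
/-- The permutations of `M_w × ℤ_{2ℓ}`, acting on the right. -/
abbrev VoltageGroup (ℓ : ℕ) : Type := (Perm (K.WhiteFlag I hI p × ZMod (2 * ℓ)))ᵐᵒᵖ

/-- The action on `M_w × ℤ_{2ℓ}` of a flag permutation `g` preserving the color of the flags:
`(Ψ, a) g = (Ψ g, a)`. -/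
def onWhite (ℓ : ℕ) (g : (Perm K.hat.V)ᵐᵒᵖ) (hg : Shifts p false g) : VoltageGroup p ℓ :=
  op (Equiv.prodCongr
    (g.unop.subtypePerm (p := fun v => p v = true) (fun v => by rw [hg v, Bool.false_xor]))
    (Equiv.refl (ZMod (2 * ℓ))))

theorem onWhite_congr (ℓ : ℕ) {g h : (Perm K.hat.V)ᵐᵒᵖ} (e : g = h) (hg : Shifts p false g)
    (hh : Shifts p false h) : onWhite ℓ g hg = onWhite ℓ h hh := by
  subst e; rfl

theorem onWhite_mul (ℓ : ℕ) {g h : (Perm K.hat.V)ᵐᵒᵖ} (hg : Shifts p false g)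
    (hh : Shifts p false h) :
    onWhite ℓ (g * h) (hg.mul hh) = onWhite ℓ g hg * onWhite ℓ h hh := rfl

theorem onWhite_one (ℓ : ℕ) :
    onWhite ℓ (1 : (Perm K.hat.V)ᵐᵒᵖ) (Shifts.one (p := p)) = 1 := rfl

/-- An involution `s` acting only on the `ℤ_{2ℓ}`-coordinate of `M_w × ℤ_{2ℓ}` and commuting with
`ρ̃₀ r₀`.  (The way in which it permutes `ℤ_{2ℓ}` may depend on the flag.) -/
structure IsSheetInvolution (hp : IsCovering K.hat (two I hI) p) (h0 : (0 : Fin (r + 3)) ∉ I)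
    {ℓ : ℕ} (s : VoltageGroup p ℓ) : Prop where
  mul_self : s * s = 1
  fst_apply : ∀ z, (s.unop z).1 = z.1
  commute : Commute s (onWhite ℓ (K.yPerm hK S φ) (shifts_yPerm hK S φ hp h0))

open Classical in
/-- The voltage assignment `ξ'`: it agrees with `ξ`, acting on `M_w × ℤ_{2ℓ}`, on the darts of
color less than `n`, and takes the value `ỹ_n = ρ̃₀ r₀ s` on the darts of color `n`. -/
noncomputable def xiPrime (hp : IsCovering K.hat (two I hI) p) (h0 : (0 : Fin (r + 3)) ∉ I)
    {ℓ : ℕ} (s : VoltageGroup p ℓ) (hs : IsSheetInvolution hK S φ hp h0 s) :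
    (two I hI).Voltage (VoltageGroup p ℓ) where
  val := fun d =>
    if d.color = Fin.last (r + 2) then
      onWhite ℓ (K.yPerm hK S φ) (shifts_yPerm hK S φ hp h0) * s
    else onWhite ℓ (K.xiVal hK S φ I hI d) (shifts_xiVal hK S φ hp h0 d)
  val_inv := by
    intro d
    by_cases hd : d.color = Fin.last (r + 2)
    · have hd' : d.inv.color = Fin.last (r + 2) := hd
      rw [if_pos hd, if_pos hd']
      symm
      apply inv_eq_of_mul_eq_one_left
      set y := onWhite ℓ (K.yPerm hK S φ) (shifts_yPerm hK S φ hp h0) with hy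
      have hyy : y * y = 1 := by
        rw [hy, ← onWhite_mul, ← onWhite_one]
        exact onWhite_congr ℓ (K.yPerm_mul_self hK S φ) _ _
      rw [mul_assoc, ← mul_assoc s, hs.commute.eq, mul_assoc, hs.mul_self, mul_one, hyy]
    · have hd' : d.inv.color ≠ Fin.last (r + 2) := hd
      rw [if_neg hd, if_neg hd']
      symm
      apply inv_eq_of_mul_eq_one_left
      rw [← onWhite_mul, ← onWhite_one]
      refine onWhite_congr ℓ ?_ _ _
      rw [K.xiVal_inv, inv_mul_cancel]

end Construction

end Premaniplex

/-!
Let `K = M_(n-1)` and `M = 2̂^K = M_n`.  Identify the flags over either vertex of `X = 2^{n+1}_I`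
with the white ones by means of `r₀`.  Then the voltage of a path acts on flags as the product of
the permutations `r_i`, `i < n`, and `ρ̃₀` attached to the colors of its darts
(`xiPrime_listVoltage_fst`).  The involution `s` only moves the sheets, and for `m = n` there is
nothing to prove, so the claim reduces to products of flag permutations: if a product `w₁` of `r_i`
with `i ≤ m < n` agrees, on the flags over `b`, with a product `w₂` of `r_i`, `k ≤ i < n`, and `ρ̃₀`,
then `w₁` is a product of `r_i` with `k ≤ i ≤ m` (`exists_flagSteps_eq_of_flagSteps_eq`).

* The sets `S_j` are never contained in the union of the closures of two vertices
  (`famSet_notCovered`).  Starting at a flag `(ψ, 0)` and avoiding the colors `0` and `1`, the vertex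
  can only alternate between that of `ψ` and its image under the reflection `ρ` of `φ`, so the
  support of the vector stays in the union of two such closures.  Hence it is no copy of `S_(n-1)`,
  and `ρ̃₀` acts as `ρ` all along (`flagStep_last_flagSteps`).
* If `ψ` is `φ` or `φ r₀`, whichever makes `(ψ, 0)` lie over `b`, then `ρ` acts as `r₀` all along.
  So `w₂` maps `(ψ, 0)` to `χ r₀ᶜ`, where `χ` is reached from `(ψ, 0)` by colors in `[k, n-1]` and
  `c` counts the occurrences of `ρ̃₀` (`exists_reach_flagSteps`).
* The colors `0` and `1` act on the underlying flag of the square.  By the previous point, `w₁` acts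
  there as `r₀ᶜ`; but if `ψ` is `φ r₁` or `φ r₁ r₀`, then `w₂` acts as the `c`-th power of the
  reflection of the square induced by `ρ`, which moves this edge otherwise than `r₀`.  So `c` is even.
* Now `w₁` maps `(ψ, 0)` to `χ`, and the intersection property of `M`, which passes from `K` to
  `2̂^K` (`HasIntersectionProperty.hat`), gives a product of `r_i`, `k ≤ i ≤ m`, that does the same.
  Since `M` is regular, this product equals `w₁`.
-/

namespace Premaniplex

/-! ### Reachability with colors in an interval -/

section Reach

variable {N : ℕ} (K : Premaniplex N)

/-- The flag `v` can be reached from `u` along edges with colors in `[k, m]`. -/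
def Reach (k m : ℕ) : K.V → K.V → Prop :=
  Relation.ReflTransGen fun a b => ∃ i : Fin N, (k ≤ (i : ℕ) ∧ (i : ℕ) ≤ m) ∧ b = K.adj i a

/-- The intersection property of abstract polytopes: flags that are joined both by a path with
colors at most `m` and by a path with colors at least `k` are joined by a path with colors in
`[k, m]`. -/
def HasIntersectionProperty : Prop :=
  ∀ (k m : ℕ) (u v : K.V), K.Reach 0 m u v → K.Reach k N u v → K.Reach k m u v

variable {K}

theorem Reach.mono {k m k' m' : ℕ} (h : ∀ i : Fin N, k ≤ (i : ℕ) → (i : ℕ) ≤ m →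
    k' ≤ (i : ℕ) ∧ (i : ℕ) ≤ m') {u v : K.V} (huv : K.Reach k m u v) : K.Reach k' m' u v :=
  Relation.ReflTransGen.mono (fun _ _ ⟨i, hi, e⟩ => ⟨i, h i hi.1 hi.2, e⟩) _ _ huv

end Reach

section ReachHat

variable {n : ℕ} {K : Premaniplex (n + 1)}

theorem Reach.fst_of_hat {k m : ℕ} {u v : K.hat.V} (h : K.hat.Reach k m u v) :
    K.Reach k m u.1 v.1 := by
  induction h with
  | refl => exact Relation.ReflTransGen.refl
  | tail _ hbc ih =>
    obtain ⟨i, hi, rfl⟩ := hbc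
    change K.Reach k m u.1 (K.hatAdj i _).1
    induction i using Fin.lastCases with
    | last => rw [hatAdj_last]; exact ih
    | cast i => rw [hatAdj_castSucc]; exact ih.tail ⟨i, hi, rfl⟩

theorem Reach.snd_of_hat {k m : ℕ} (hm : m < n + 1) {u v : K.hat.V} (h : K.hat.Reach k m u v) :
    v.2 = u.2 := by
  induction h with
  | refl => rfl
  | tail _ hbc ih =>
    obtain ⟨i, hi, rfl⟩ := hbc
    change (K.hatAdj i _).2 = u.2
    induction i using Fin.lastCases with
    | last => simp at hi; omega
    | cast i => rw [hatAdj_castSucc]; exact ih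

theorem Reach.hat {k m : ℕ} (x : K.Facet → ZMod 2) {u v : K.V} (h : K.Reach k m u v) :
    K.hat.Reach k m (u, x) (v, x) := by
  induction h with
  | refl => exact Relation.ReflTransGen.refl
  | tail _ hbc ih =>
    obtain ⟨i, hi, rfl⟩ := hbc
    exact Relation.ReflTransGen.tail ih ⟨i.castSucc, hi, (K.hatAdj_castSucc i (_, x)).symm⟩

theorem HasIntersectionProperty.hat (hK : K.HasIntersectionProperty) :
    K.hat.HasIntersectionProperty := by
  rintro k m ⟨u, x⟩ ⟨v, y⟩ h0 hk
  by_cases hm : n + 1 ≤ m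
  · exact hk.mono fun i hi _ => ⟨hi, by omega⟩
  · obtain rfl : y = x := h0.snd_of_hat (by omega)
    exact (hK k m u v h0.fst_of_hat
      (hk.fst_of_hat.mono fun i hi _ => ⟨hi, by omega⟩)).hat y

theorem square_hasIntersectionProperty : square.HasIntersectionProperty := by
  intro k m u v h0 hk
  by_cases hm : 1 ≤ m
  · exact hk.mono fun i hi _ => ⟨hi, by omega⟩
  by_cases hk0 : k = 0
  · subst hk0; exact h0
  -- Here `h0` only uses color `0` and `hk` only uses color `1`, which preserves the vertex.
  have h1 : v.1 = u.1 := by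
    clear h0
    induction hk with
    | refl => rfl
    | tail _ hbc ih =>
      obtain ⟨i, hi, rfl⟩ := hbc
      have : i = 1 := by omega
      subst this
      exact ih
  have h2 : v = u ∨ v = squareAdj 0 u := by
    clear hk h1
    induction h0 with
    | refl => exact Or.inl rfl
    | tail _ hbc ih =>
      obtain ⟨i, hi, rfl⟩ := hbc
      have : i = 0 := by omega
      subst this
      rcases ih with rfl | rfl
      · exact Or.inr rfl
      · exact Or.inl (square.adj_adj 0 u)
  have h3 : ∀ w : ZMod 4 × Bool, (squareAdj 0 w).1 ≠ w.1 := by decide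
  rcases h2 with rfl | rfl
  · exact Relation.ReflTransGen.refl
  · exact absurd h1 (h3 u)

theorem fam_hasIntersectionProperty : ∀ j, (fam j).HasIntersectionProperty
  | 0 => square_hasIntersectionProperty
  | j + 1 => (fam_hasIntersectionProperty j).hat

end ReachHat

/-! ### Sets of facets not covered by two vertices -/

section Vertices

variable {n : ℕ} (K : Premaniplex (n + 1))

/-- No two vertices are together incident to all facets in `S`. -/
def NotCovered (S : Set K.Facet) : Prop :=
  ∀ u v : K.Face 0, ¬ S ⊆ K.closure u ∪ K.closure v

variable {K}

theorem facet_mem_closure (i : Fin (n + 1)) (v : K.V) : K.facet v ∈ K.closure (K.face i v) :=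
  ⟨v, rfl, rfl⟩

theorem faceMap_mem_closure {i : Fin (n + 1)} (γ : K.Aut) {f : K.Face i} {F : K.Facet}
    (h : F ∈ K.closure f) : K.faceMap _ γ F ∈ K.closure (K.faceMap i γ f) := by
  obtain ⟨v, rfl, rfl⟩ := h
  exact ⟨(γ : Perm K.V) v, rfl, rfl⟩

theorem NotCovered.image {S : Set K.Facet} (hS : K.NotCovered S) (γ : K.Aut) :
    K.NotCovered (K.faceMap (Fin.last n) γ '' S) := by
  intro u v h
  refine hS (K.faceMap 0 γ⁻¹ u) (K.faceMap 0 γ⁻¹ v) fun F hF => ?_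
  rw [← K.faceMap_inv _ γ F]
  exact (h ⟨F, hF, rfl⟩).imp (faceMap_mem_closure γ⁻¹) (faceMap_mem_closure γ⁻¹)

theorem hatAdj_snd_apply_of_notMem {u : K.hat.V} {F : K.Facet}
    (hF : F ∉ K.closure (K.face 0 u.1)) (i : Fin (n + 2)) : (K.hatAdj i u).2 F = u.2 F := by
  induction i using Fin.lastCases with
  | last =>
    have : F ≠ K.facet u.1 := by rintro rfl; exact hF (facet_mem_closure 0 _)
    simp [hatAdj_last, chi, this]
  | cast i => rw [hatAdj_castSucc]

/-- Two flags of `2̂^K` with the same vertex project to flags of `K` with the same vertex `v`, and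
their vectors differ at most on the facets at `v`. -/
theorem sameFace_zero_hat {u v : K.hat.V} (h : K.hat.SameFace 0 u v) :
    K.face 0 v.1 = K.face 0 u.1 ∧ ∀ F ∉ K.closure (K.face 0 u.1), v.2 F = u.2 F := by
  induction h with
  | refl => exact ⟨rfl, fun _ _ => rfl⟩
  | @tail b c _ hbc ih =>
    obtain ⟨i, hi, rfl⟩ := hbc
    change K.face 0 (K.hatAdj i b).1 = _ ∧ ∀ F ∉ _, (K.hatAdj i b).2 F = _
    refine ⟨?_, fun F hF => ?_⟩
    · induction i using Fin.lastCases with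
      | last => rw [hatAdj_last]; exact ih.1
      | cast i =>
        rw [hatAdj_castSucc, K.face_adj (fun h => hi (by rw [h]; rfl))]
        exact ih.1
    · rw [hatAdj_snd_apply_of_notMem (by rwa [ih.1]), ih.2 F hF]

theorem sameFace_last_hat {u v : K.hat.V} (h : K.hat.SameFace (Fin.last (n + 1)) u v) :
    v.2 = u.2 := by
  induction h with
  | refl => rfl
  | @tail b c _ hbc ih =>
    obtain ⟨i, hi, rfl⟩ := hbc
    change (K.hatAdj i b).2 = _
    induction i using Fin.lastCases with
    | last => exact absurd rfl hi
    | cast i => rw [hatAdj_castSucc]; exact ih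

theorem eq_of_facet_mem_closure_hat {u w : K.hat.V}
    (h : K.hat.facet w ∈ K.hat.closure (K.hat.face 0 u)) {F : K.Facet}
    (hF : F ∉ K.closure (K.face 0 u.1)) : w.2 F = u.2 F := by
  obtain ⟨v, hv, hw⟩ := h
  have h1 : K.hat.SameFace 0 v u := Quotient.exact (s := K.hat.faceSetoid 0) hv
  have h2 : K.hat.SameFace (Fin.last _) v w := Quotient.exact (s := K.hat.faceSetoid _) hw
  rw [sameFace_last_hat h2, (sameFace_zero_hat (K.hat.sameFace_symm 0 h1)).2 F hF]

theorem NotCovered.hatSet {S : Set K.Facet} (hS : K.NotCovered S) :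
    K.hat.NotCovered (K.hatSet S) := by
  -- It suffices to treat vertices `u`, `v` such that the facet with vector `0` contains `u`.
  have key : ∀ u v : K.hat.V, ∀ w : K.V,
      K.hat.facet (w, 0) ∈ K.hat.closure (K.hat.face 0 u) →
      ¬ K.hatSet S ⊆ K.hat.closure (K.hat.face 0 u) ∪ K.hat.closure (K.hat.face 0 v) := by
    intro u v w h0 h
    have hu : ∀ F ∈ S, K.hat.facet (w, K.chi F) ∈ K.hat.closure (K.hat.face 0 u) →
        F ∈ K.closure (K.face 0 u.1) := by
      intro F _ hF
      by_contra hn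
      have h1 := (eq_of_facet_mem_closure_hat hF hn).trans (eq_of_facet_mem_closure_hat h0 hn).symm
      simp [chi] at h1
    have hS' : ∀ F ∈ S, _ := fun F hF => h ⟨w, K.chi F, rfl, Or.inr ⟨F, hF, rfl⟩⟩
    by_cases hv : ∃ F₀ ∈ S, K.hat.facet (w, K.chi F₀) ∈ K.hat.closure (K.hat.face 0 v) ∧
        F₀ ∉ K.closure (K.face 0 v.1)
    · -- Then `F₀` is the only facet `F ∈ S` with `χ_F` at `v`, so any vertex of `F₀` covers it.
      obtain ⟨F₀, _, h₁, h₂⟩ := hv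
      obtain ⟨c, hc⟩ : ∃ c, K.facet c = F₀ := Quotient.exists_rep F₀
      refine hS (K.face 0 u.1) (K.face 0 c) fun F hF => ?_
      refine (hS' F hF).imp (hu F hF) fun h₃ => ?_
      have h₄ := (eq_of_facet_mem_closure_hat h₃ h₂).trans (eq_of_facet_mem_closure_hat h₁ h₂).symm
      have h₅ : K.facet c = F := by
        by_contra hne
        simp [chi, ← hc, hne] at h₄
      exact h₅ ▸ facet_mem_closure 0 c
    · push Not at hv
      exact hS (K.face 0 u.1) (K.face 0 v.1) fun F hF =>
        (hS' F hF).imp (hu F hF) (hv F hF)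
  intro f g h
  obtain ⟨u, rfl⟩ := Quotient.exists_rep f
  obtain ⟨v, rfl⟩ := Quotient.exists_rep g
  rcases h ⟨u.1, 0, rfl, Or.inl rfl⟩ with h0 | h0
  · exact key u v _ h0 h
  · exact key v u _ h0 (by rw [Set.union_comm]; exact h)

end Vertices

theorem famSet_notCovered {S₃ : Set (fam 1).Facet} (h : (fam 1).NotCovered S₃) :
    ∀ t, (fam (t + 1)).NotCovered (famSet S₃ t)
  | 0 => h
  | t + 1 => (famSet_notCovered h t).hatSet

/-! ### The projection onto the square -/

/-- The action of the edges of color `i` of a maniplex of the family `fam` on the underlying flag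
of the square: colors `0` and `1` act as in the square, the other ones trivially. -/
def squareStep (i : ℕ) (v : ZMod 4 × Bool) : ZMod 4 × Bool :=
  if i = 0 then squareAdj 0 v else if i = 1 then squareAdj 1 v else v

theorem squareStep_aut (σ : square.Aut) (i : ℕ) (v : ZMod 4 × Bool) :
    squareStep i ((σ : Perm square.V) v) = (σ : Perm square.V) (squareStep i v) := by
  unfold squareStep
  split_ifs
  · exact (σ.2 0 v).symm
  · exact (σ.2 1 v).symm
  · rfl

theorem foldr_squareStep_aut (σ : square.Aut) (L : List ℕ) (v : ZMod 4 × Bool) :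
    L.foldr squareStep ((σ : Perm square.V) v) = (σ : Perm square.V) (L.foldr squareStep v) := by
  induction L with
  | nil => rfl
  | cons i L ih => rw [List.foldr_cons, ih, squareStep_aut, List.foldr_cons]

/-- A map from the flags of `K` to those of the square is a projection if it is compatible with
the colors `0` and `1` and invariant under all other ones. -/
def IsSquareProjection {N : ℕ} (K : Premaniplex N) (q : K.V → ZMod 4 × Bool) : Prop :=
  ∀ i v, q (K.adj i v) = squareStep i (q v)

theorem IsSquareProjection.hat {n : ℕ} {K : Premaniplex (n + 2)} {q : K.V → ZMod 4 × Bool}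
    (hq : K.IsSquareProjection q) (i : Fin (n + 3)) (v : K.hat.V) :
    q (K.hat.adj i v).1 = squareStep i (q v.1) := by
  change q (K.hatAdj i v).1 = _
  induction i using Fin.lastCases with
  | last => rw [hatAdj_last]; simp [squareStep]
  | cast i => rw [hatAdj_castSucc, hq]; rfl

theorem fam_exists_isSquareProjection : ∀ j, ∃ q, (fam j).IsSquareProjection q
  | 0 => by
    refine ⟨id, fun i v => ?_⟩
    change squareAdj i v = squareStep i v
    fin_cases i <;> rfl
  | j + 1 => by
    obtain ⟨q, hq⟩ := fam_exists_isSquareProjection j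
    exact ⟨fun v => q v.1, hq.hat⟩

/-- If an automorphism `γ` of `K` and an automorphism `σ` of the square agree on one flag, then
`γ` induces `σ` on the square. -/
theorem IsSquareProjection.aut {N : ℕ} {K : Premaniplex N} {q : K.V → ZMod 4 × Bool}
    (hq : K.IsSquareProjection q) (γ : K.Aut) (σ : square.Aut) {u : K.V}
    (hu : q ((γ : Perm K.V) u) = (σ : Perm square.V) (q u)) (v : K.V) :
    q ((γ : Perm K.V) v) = (σ : Perm square.V) (q v) := by
  induction K.connected u v with
  | refl => exact hu
  | tail _ hbc ih =>
    obtain ⟨i, rfl⟩ := hbc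
    rw [Aut.map_adj, hq, hq, ih, squareStep_aut]

/-! ### The flag permutations underlying the voltages -/

section FlagStep

variable {r : ℕ} (K : Premaniplex (r + 1)) (hK : K.IsRegular) (S : Set K.Facet) (φ : K.V)

/-- The flag permutation of `2̂^K` attached to the color `i` of `2^{n+1}_I`: the adjacency of color
`i` if `i < n`, and `ρ̃₀` if `i = n`. -/
noncomputable def flagStep (i : Fin (r + 3)) (v : K.hat.V) : K.hat.V :=
  if h : (i : ℕ) < r + 2 then K.hat.adj ⟨i, h⟩ v else (K.rhoTilde hK S φ).unop v

/-- The composition of the flag permutations attached to a list of colors, the last color acting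
first. -/
noncomputable def flagSteps (L : List (Fin (r + 3))) (v : K.hat.V) : K.hat.V :=
  L.foldr (K.flagStep hK S φ) v

theorem flagStep_of_lt {i : Fin (r + 3)} (h : (i : ℕ) < r + 2) (v : K.hat.V) :
    K.flagStep hK S φ i v = K.hat.adj ⟨i, h⟩ v := dif_pos h

theorem flagStep_last (v : K.hat.V) : K.flagStep hK S φ (Fin.last (r + 2)) v =
    ((K.facetReflection hK S φ v.2 : Perm K.V) v.1, v.2) := dif_neg (by simp)

theorem flagSteps_cons (i : Fin (r + 3)) (L : List (Fin (r + 3))) (v : K.hat.V) :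
    K.flagSteps hK S φ (i :: L) v = K.flagStep hK S φ i (K.flagSteps hK S φ L v) := rfl

theorem flagSteps_aut {L : List (Fin (r + 3))} (hL : ∀ i ∈ L, (i : ℕ) < r + 2) (γ : K.hat.Aut)
    (v : K.hat.V) : K.flagSteps hK S φ L ((γ : Perm K.hat.V) v) =
      (γ : Perm K.hat.V) (K.flagSteps hK S φ L v) := by
  induction L with
  | nil => rfl
  | cons i L ih =>
    have hi := hL i List.mem_cons_self
    rw [flagSteps_cons, flagSteps_cons, ih fun j hj => hL j (List.mem_cons_of_mem i hj),
      K.flagStep_of_lt hK S φ hi, K.flagStep_of_lt hK S φ hi, Aut.map_adj]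

/-- As `2̂^K` is regular, two products of its color permutations that agree on one flag are
equal. -/
theorem flagSteps_eq_of_apply_eq {L L' : List (Fin (r + 3))} (hL : ∀ i ∈ L, (i : ℕ) < r + 2)
    (hL' : ∀ i ∈ L', (i : ℕ) < r + 2) {u : K.hat.V}
    (h : K.flagSteps hK S φ L u = K.flagSteps hK S φ L' u) (v : K.hat.V) :
    K.flagSteps hK S φ L v = K.flagSteps hK S φ L' v := by
  obtain ⟨γ, rfl⟩ := K.hat_isRegular hK u v
  rw [flagSteps_aut K hK S φ hL, flagSteps_aut K hK S φ hL', h]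

theorem reach_flagSteps {k m : ℕ} {L : List (Fin (r + 3))}
    (hL : ∀ i ∈ L, (i : ℕ) < r + 2 ∧ k ≤ (i : ℕ) ∧ (i : ℕ) ≤ m) (v : K.hat.V) :
    K.hat.Reach k m v (K.flagSteps hK S φ L v) := by
  induction L with
  | nil => exact Relation.ReflTransGen.refl
  | cons i L ih =>
    have hi := hL i List.mem_cons_self
    refine (ih fun j hj => hL j (List.mem_cons_of_mem i hj)).tail ⟨⟨i, hi.1⟩, hi.2, ?_⟩
    rw [flagSteps_cons, K.flagStep_of_lt hK S φ hi.1]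

variable {K S φ} in
theorem Reach.exists_flagSteps_eq {k m : ℕ} {u v : K.hat.V} (h : K.hat.Reach k m u v) :
    ∃ L : List (Fin (r + 3)), (∀ i ∈ L, (i : ℕ) < r + 2 ∧ k ≤ (i : ℕ) ∧ (i : ℕ) ≤ m) ∧
      K.flagSteps hK S φ L u = v := by
  induction h with
  | refl => exact ⟨[], by simp, rfl⟩
  | tail _ hbc ih =>
    obtain ⟨i, hi, rfl⟩ := hbc
    obtain ⟨L, hL, rfl⟩ := ih
    refine ⟨i.castSucc :: L, ?_, ?_⟩
    · intro j hj
      rcases List.mem_cons.mp hj with rfl | hj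
      · exact ⟨i.isLt, hi⟩
      · exact hL j hj
    · rw [flagSteps_cons, K.flagStep_of_lt hK S φ i.isLt]; rfl

/-- The automorphism of `K` that reflects the base flag `φ` of the facet with vector `0`. -/
noncomputable def baseReflection : K.Aut := K.autOf hK φ (K.adj 0 φ)

theorem baseReflection_apply : (K.baseReflection hK φ : Perm K.V) φ = K.adj 0 φ :=
  K.autOf_apply hK _ _

theorem baseReflection_mul_self : K.baseReflection hK φ * K.baseReflection hK φ = 1 := by
  apply Aut.eq_of_apply_eq K φ
  simp only [Subgroup.coe_mul, Perm.mul_apply, Subgroup.coe_one, Perm.one_apply]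
  rw [baseReflection_apply, Aut.map_adj, baseReflection_apply, K.adj_adj]

variable {K S φ} in
/-- A facet whose vector is supported at two vertices has base flag `φ`, as its support is no copy
of `S`. -/
theorem facetReflection_eq_baseReflection
    (hS : K.NotCovered S) {x : K.Facet → ZMod 2} {u v : K.Face 0}
    (hx : Function.support x ⊆ K.closure u ∪ K.closure v) :
    K.facetReflection hK S φ x = K.baseReflection hK φ := by
  have hb : K.baseFlag S φ x = φ := by
    unfold baseFlag
    exact dif_neg fun ⟨γ, hγ⟩ => hS.image γ u v (hγ ▸ hx)
  unfold facetReflection baseReflection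
  rw [hb]

end FlagStep

section Orbit

variable {r : ℕ} {K : Premaniplex (r + 1 + 1)} (hK : K.IsRegular) {S : Set K.Facet} {φ : K.V}
  {q : K.V → ZMod 4 × Bool}

theorem squareProjection_flagSteps (hq : K.IsSquareProjection q) {L : List (Fin (r + 1 + 3))}
    (hL : ∀ i ∈ L, (i : ℕ) < r + 1 + 2) (v : K.hat.V) :
    q (K.flagSteps hK S φ L v).1 =
      (L.map fun i : Fin (r + 1 + 3) => (i : ℕ)).foldr squareStep (q v.1) := by
  induction L with
  | nil => rfl
  | cons i L ih =>
    have hi := hL i List.mem_cons_self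
    rw [flagSteps_cons, K.flagStep_of_lt hK S φ hi, hq.hat ⟨i, hi⟩,
      ih fun j hj => hL j (List.mem_cons_of_mem i hj)]
    rfl

/-- The flags obtained from `(ψ, 0)` without the colors `0` and `1` stay at the vertex `v` of `ψ`
and its mirror image `v'`, and their vectors are supported on the facets at these vertices. -/
theorem flagSteps_vertex (hS : K.NotCovered S) {L : List (Fin (r + 1 + 3))}
    (hL : ∀ i ∈ L, 2 ≤ (i : ℕ)) (ψ : K.V) :
    (K.face 0 (K.flagSteps hK S φ L (ψ, 0)).1 = K.face 0 ψ ∨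
      K.face 0 (K.flagSteps hK S φ L (ψ, 0)).1 =
        K.faceMap 0 (K.baseReflection hK φ) (K.face 0 ψ)) ∧
    Function.support (K.flagSteps hK S φ L (ψ, 0)).2 ⊆ K.closure (K.face 0 ψ) ∪
      K.closure (K.faceMap 0 (K.baseReflection hK φ) (K.face 0 ψ)) := by
  induction L with
  | nil => exact ⟨Or.inl rfl, by simp [flagSteps]⟩
  | cons i L ih =>
    obtain ⟨h1, h2⟩ := ih fun j hj => hL j (List.mem_cons_of_mem i hj)
    have hi := hL i List.mem_cons_self
    rw [flagSteps_cons]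
    generalize K.flagSteps hK S φ L (ψ, 0) = w at h1 h2 ⊢
    induction i using Fin.lastCases with
    | last =>
      rw [flagStep_last, facetReflection_eq_baseReflection hK hS h2]
      refine ⟨?_, h2⟩
      change K.faceMap 0 _ (K.face 0 w.1) = _ ∨ K.faceMap 0 _ (K.face 0 w.1) = _
      rcases h1 with h1 | h1
      · exact Or.inr (by rw [h1])
      · refine Or.inl ?_
        have hinv : (K.baseReflection hK φ)⁻¹ = K.baseReflection hK φ :=
          inv_eq_of_mul_eq_one_left (K.baseReflection_mul_self hK φ)
        have := K.faceMap_inv 0 (K.baseReflection hK φ) (K.face 0 ψ)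
        rw [hinv] at this
        rw [h1, this]
    | cast i =>
      rw [K.flagStep_of_lt hK S φ i.isLt]
      change (K.face 0 (K.hatAdj i w).1 = _ ∨ K.face 0 (K.hatAdj i w).1 = _) ∧
        Function.support (K.hatAdj i w).2 ⊆ _
      constructor
      · have : K.face 0 (K.hatAdj i w).1 = K.face 0 w.1 := by
          induction i using Fin.lastCases with
          | last => rw [hatAdj_last]
          | cast i =>
            rw [hatAdj_castSucc, K.face_adj]
            rintro rfl
            simp at hi
        rwa [this]
      · intro F hF
        by_cases hw : F ∈ K.closure (K.face 0 w.1)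
        · rcases h1 with h1 | h1
          · exact Or.inl (h1 ▸ hw)
          · exact Or.inr (h1 ▸ hw)
        · rw [Function.mem_support, hatAdj_snd_apply_of_notMem hw] at hF
          exact h2 hF

/-- On the flags obtained from `(ψ, 0)` without the colors `0` and `1`, the permutation `ρ̃₀` acts
as one and the same reflection. -/
theorem flagStep_last_flagSteps (hS : K.NotCovered S) {L : List (Fin (r + 1 + 3))}
    (hL : ∀ i ∈ L, 2 ≤ (i : ℕ)) (ψ : K.V) :
    K.flagStep hK S φ (Fin.last _) (K.flagSteps hK S φ L (ψ, 0)) =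
      ((K.baseReflection hK φ : Perm K.V) (K.flagSteps hK S φ L (ψ, 0)).1,
        (K.flagSteps hK S φ L (ψ, 0)).2) := by
  rw [flagStep_last, facetReflection_eq_baseReflection hK hS (flagSteps_vertex hK hS hL ψ).2]

/-- If `σ` is the reflection of the square induced by the reflection of `φ`, then the projection
of the flag obtained from `(ψ, 0)` is transformed by `σ` once for each occurrence of `ρ̃₀`. -/
theorem squareProjection_flagSteps_of_two_le (hS : K.NotCovered S) (hq : K.IsSquareProjection q)
    (σ : square.Aut) (hσ : (σ : Perm square.V) (q φ) = squareAdj 0 (q φ))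
    {L : List (Fin (r + 1 + 3))} (hL : ∀ i ∈ L, 2 ≤ (i : ℕ)) (ψ : K.V) :
    q (K.flagSteps hK S φ L (ψ, 0)).1 =
      (σ : Perm square.V)^[L.count (Fin.last _)] (q ψ) := by
  induction L with
  | nil => rfl
  | cons i L ih =>
    have hL' : ∀ j ∈ L, 2 ≤ (j : ℕ) := fun j hj => hL j (List.mem_cons_of_mem i hj)
    have hi := hL i List.mem_cons_self
    rw [flagSteps_cons]
    induction i using Fin.lastCases with
    | last =>
      rw [flagStep_last_flagSteps hK hS hL', List.count_cons_self, Function.iterate_succ_apply',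
        ← ih hL']
      refine hq.aut (u := φ) _ σ ?_ _
      rw [baseReflection_apply, hq, hσ]
      rfl
    | cast i =>
      rw [K.flagStep_of_lt hK S φ i.isLt]
      change q (K.hat.adj i _).1 = _
      rw [hq.hat i, List.count_cons_of_ne (Fin.castSucc_lt_last i).ne]
      simp only [ih hL', squareStep]
      have hi' : 2 ≤ (i : ℕ) := hi
      rw [if_neg (show ¬ (i : ℕ) = 0 by omega), if_neg (show ¬ (i : ℕ) = 1 by omega)]

/-- Starting at `(ψ, 0)`, where `ψ` is mapped to `ψ r₀` by the reflection of `φ`, and using only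
colors at least `k ≥ 2`, the permutation `ρ̃₀` acts as `r₀` all along.  As `r₀` commutes with all
`r_i`, `i ≥ 2`, these factors can be collected. -/
theorem exists_reach_flagSteps (hS : K.NotCovered S) {k : ℕ} (hk : 2 ≤ k)
    {L : List (Fin (r + 1 + 3))} (hL : ∀ i ∈ L, k ≤ (i : ℕ)) {ψ : K.V}
    (hψ : (K.baseReflection hK φ : Perm K.V) ψ = K.adj 0 ψ) :
    ∃ w, K.hat.Reach k (r + 1 + 2) (ψ, 0) w ∧
      K.flagSteps hK S φ L (ψ, 0) = (K.hat.adj 0)^[L.count (Fin.last _)] w ∧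
      (K.baseReflection hK φ : Perm K.V) (K.flagSteps hK S φ L (ψ, 0)).1 =
        K.adj 0 (K.flagSteps hK S φ L (ψ, 0)).1 := by
  induction L with
  | nil => exact ⟨_, Relation.ReflTransGen.refl, rfl, hψ⟩
  | cons i L ih =>
    have hL' : ∀ j ∈ L, k ≤ (j : ℕ) := fun j hj => hL j (List.mem_cons_of_mem i hj)
    have hi := hL i List.mem_cons_self
    obtain ⟨w, h1, h2, h3⟩ := ih hL'
    rw [flagSteps_cons]
    induction i using Fin.lastCases with
    | last =>
      rw [flagStep_last_flagSteps hK hS fun j hj => hk.trans (hL' j hj)]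
      refine ⟨w, h1, ?_, ?_⟩
      · rw [List.count_cons_self, Function.iterate_succ_apply', ← h2, h3]
        exact (K.hatAdj_castSucc 0 _).symm
      · simp only
        rw [h3, Aut.map_adj, h3]
    | cast i =>
      rw [K.flagStep_of_lt hK S φ i.isLt, List.count_cons_of_ne (Fin.castSucc_lt_last i).ne]
      have hi' : k ≤ (i : ℕ) := hi
      have hcomm : ∀ v, K.hat.adj 0 (K.hat.adj i v) = K.hat.adj i (K.hat.adj 0 v) :=
        K.hat.adj_comm 0 i (by simp; omega)
      refine ⟨K.hat.adj i w, h1.tail ⟨i, ⟨hi', by omega⟩, rfl⟩, ?_, ?_⟩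
      · rw [h2]
        exact (Function.Commute.iterate_left (f := K.hat.adj 0) (g := K.hat.adj i) hcomm _ w).symm
      · generalize K.flagSteps hK S φ L (ψ, 0) = y at h3 ⊢
        change (K.baseReflection hK φ : Perm K.V) (K.hatAdj i y).1 = K.adj 0 (K.hatAdj i y).1
        induction i using Fin.lastCases with
        | last => rw [hatAdj_last]; exact h3
        | cast i =>
          have hi2 : k ≤ (i : ℕ) := hi'
          rw [hatAdj_castSucc]
          simp only
          rw [Aut.map_adj, h3, K.adj_comm 0 i (by simp; omega)]

theorem square_adj_one_ne : ∀ s : ZMod 4 × Bool,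
    squareAdj 0 (squareAdj 1 s) ≠ squareAdj 1 (squareAdj 0 s) := by decide

/-- The intersection property for the flag permutations underlying the voltages, restricted to the
flags satisfying `P`.  Two of the flags `(ψ, 0)` have to satisfy `P`: one with the same edge as
`φ`, and one with the same edge as `φ r₁`. -/
theorem exists_flagSteps_eq_of_flagSteps_eq (hS : K.NotCovered S) (hq : K.IsSquareProjection q)
    (hI : K.HasIntersectionProperty) {k m : ℕ} (hk : 2 ≤ k) {L₁ L₂ : List (Fin (r + 1 + 3))}
    (h₁ : ∀ i ∈ L₁, (i : ℕ) < r + 1 + 2 ∧ (i : ℕ) ≤ m) (h₂ : ∀ i ∈ L₂, k ≤ (i : ℕ))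
    {P : K.hat.V → Prop} (hP : ∀ v, P v ∨ P (K.hat.adj 0 v))
    (h : ∀ v, P v → K.flagSteps hK S φ L₁ v = K.flagSteps hK S φ L₂ v) :
    ∃ L₃ : List (Fin (r + 1 + 3)), (∀ i ∈ L₃, (i : ℕ) < r + 1 + 2 ∧ k ≤ (i : ℕ) ∧ (i : ℕ) ≤ m) ∧
      ∀ v, K.flagSteps hK S φ L₃ v = K.flagSteps hK S φ L₁ v := by
  have h₁' : ∀ i ∈ L₁, (i : ℕ) < r + 1 + 2 := fun i hi => (h₁ i hi).1
  have hadj : ∀ v : K.V, K.hat.adj 0 (v, 0) = (K.adj 0 v, 0) := fun v => K.hatAdj_castSucc 0 (v, 0)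
  set c := L₂.count (Fin.last _) with hc
  obtain ⟨σ, hσ⟩ := square_isRegular (q φ) (squareAdj 0 (q φ))
  obtain ⟨ψ, hψ, hψφ⟩ : ∃ ψ, P (ψ, 0) ∧ (ψ = φ ∨ ψ = K.adj 0 φ) := by
    rcases hP (φ, 0) with h0 | h0
    · exact ⟨φ, h0, Or.inl rfl⟩
    · exact ⟨K.adj 0 φ, hadj φ ▸ h0, Or.inr rfl⟩
  obtain ⟨ψ', hψ', hψφ'⟩ : ∃ ψ', P (ψ', 0) ∧
      (ψ' = K.adj 1 φ ∨ ψ' = K.adj 0 (K.adj 1 φ)) := by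
    rcases hP (K.adj 1 φ, 0) with h0 | h0
    · exact ⟨_, h0, Or.inl rfl⟩
    · exact ⟨_, hadj _ ▸ h0, Or.inr rfl⟩
  have hρ : (K.baseReflection hK φ : Perm K.V) ψ = K.adj 0 ψ := by
    rcases hψφ with rfl | rfl
    · exact K.baseReflection_apply hK _
    · rw [Aut.map_adj, baseReflection_apply]
  obtain ⟨w, hw, hw', -⟩ := exists_reach_flagSteps hK hS hk h₂ hρ
  rw [← h _ hψ, ← hc] at hw'
  -- The projection of `L₁` to the square acts as `r₀ᶜ` on one flag, hence on all of them.
  have hL₁ : ∀ s, (L₁.map fun i : Fin (r + 1 + 3) => (i : ℕ)).foldr squareStep s =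
      (squareAdj 0)^[c] s := by
    have hwq : q w.1 = q ψ := by
      clear hw'
      induction hw with
      | refl => rfl
      | tail _ hbc ih =>
        obtain ⟨i, hi, rfl⟩ := hbc
        rw [hq.hat, squareStep, if_neg (by omega), if_neg (by omega), ih]
    have hit : ∀ (d : ℕ) (v : K.hat.V),
        q ((K.hat.adj 0)^[d] v).1 = (squareAdj 0)^[d] (q v.1) := by
      intro d v
      induction d with
      | zero => rfl
      | succ d ih =>
        rw [Function.iterate_succ_apply', Function.iterate_succ_apply', ← ih]
        exact hq.hat 0 _
    have h0 := squareProjection_flagSteps hK (S := S) (φ := φ) hq h₁' (ψ, 0)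
    rw [hw', hit, hwq] at h0
    intro s
    obtain ⟨τ, rfl⟩ := square_isRegular (q ψ) s
    rw [foldr_squareStep_aut, ← h0]
    exact Function.Commute.iterate_right (f := (τ : Perm square.V)) (g := squareAdj 0)
      (fun v => τ.2 0 v) c _
  -- On `ψ'` it acts as `σᶜ`, and `σ` and `r₀` move the edge of `φ r₁` differently.
  have heven : Even c := by
    by_contra hodd
    rw [Nat.not_even_iff_odd] at hodd
    have h0 := squareProjection_flagSteps hK (S := S) (φ := φ) hq h₁' (ψ', 0)
    rw [h _ hψ', squareProjection_flagSteps_of_two_le hK hS hq σ hσ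
      (fun i hi => hk.trans (h₂ i hi)), ← hc, hL₁] at h0
    have hr0 : Function.Involutive (squareAdj 0) := square.adj_adj 0
    have hσσ : Function.Involutive (σ : Perm square.V) := by
      have : σ * σ = 1 := by
        apply Aut.eq_of_apply_eq square (q φ)
        change (σ : Perm square.V) ((σ : Perm square.V) (q φ)) = q φ
        rw [hσ]
        exact (σ.2 0 _).trans ((congrArg _ hσ).trans (hr0 _))
      intro v
      exact congrArg (fun τ : square.Aut => (τ : Perm square.V) v) this
    rw [hr0.iterate_odd hodd, hσσ.iterate_odd hodd] at h0
    have h1 : (σ : Perm square.V) (squareAdj 1 (q φ)) = squareAdj 1 (squareAdj 0 (q φ)) :=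
      (σ.2 1 _).trans (congrArg _ hσ)
    have hq0 : ∀ v, q (K.adj 0 v) = squareAdj 0 (q v) := hq 0
    have hq1 : ∀ v, q (K.adj 1 v) = squareAdj 1 (q v) := hq 1
    rcases hψφ' with rfl | rfl
    · rw [hq1, h1] at h0
      exact square_adj_one_ne _ h0.symm
    · rw [hq0, hq1] at h0
      have h2 : (σ : Perm square.V) (squareAdj 0 (squareAdj 1 (q φ))) =
          squareAdj 0 (squareAdj 1 (squareAdj 0 (q φ))) := (σ.2 0 _).trans (congrArg _ h1)
      rw [h2] at h0
      exact square_adj_one_ne _ (hr0.injective h0).symm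
  have hinv : Function.Involutive (K.hat.adj 0) := K.hat.adj_adj 0
  rw [hinv.iterate_even heven] at hw'
  have hr : K.hat.Reach k m (ψ, 0) w := by
    refine hI.hat k m _ _ ?_ (hw.mono fun i hi hi' => ⟨hi, by omega⟩)
    have := K.reach_flagSteps hK S φ (k := 0) (m := m)
      (fun i hi => ⟨(h₁ i hi).1, Nat.zero_le _, (h₁ i hi).2⟩) (ψ, 0)
    rw [hw'] at this
    exact this
  obtain ⟨L₃, hL₃, e⟩ := hr.exists_flagSteps_eq hK (φ := φ) (S := S)
  exact ⟨L₃, hL₃, K.flagSteps_eq_of_apply_eq hK S φ (fun i hi => (hL₃ i hi).1) h₁'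
    (e.trans hw'.symm)⟩

end Orbit

/-! ### Voltages of paths -/

section Voltages

variable {r : ℕ} {K : Premaniplex (r + 1)} (hK : K.IsRegular) (S : Set K.Facet) (φ : K.V)
  {I : Set (Fin (r + 3))} {hI : I ≠ Set.univ} {p : K.hat.V → (two I hI).V}

/-- The identity for the white vertex and `r₀` for the black one: this identifies the white flags
with the flags over the given vertex. -/
noncomputable def whiten (a : Bool) (v : K.hat.V) : K.hat.V := if a = true then v else K.hat.adj 0 v

theorem whiten_whiten (a : Bool) (v : K.hat.V) : whiten a (whiten a v) = v := by
  cases a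
  · exact K.hat.adj_adj 0 v
  · rfl

theorem color_adj_zero (hp : IsCovering K.hat (two I hI) p) (h0 : (0 : Fin (r + 3)) ∉ I)
    (v : K.hat.V) : p (K.hat.adj 0 v) = !(p v) :=
  (hp 0 v).trans (if_neg h0)

theorem color_whiten (hp : IsCovering K.hat (two I hI) p) (h0 : (0 : Fin (r + 3)) ∉ I)
    {a : Bool} {v : K.hat.V} (hv : p v = a) : p (whiten a v) = true := by
  cases a
  · exact (color_adj_zero hp h0 v).trans (by rw [hv]; rfl)
  · exact hv

variable (hp : IsCovering K.hat (two I hI) p) (h0 : (0 : Fin (r + 3)) ∉ I)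
  {ℓ : ℕ} {s : VoltageGroup p ℓ}
  (hs : IsSheetInvolution hK S φ hp h0 s)

theorem xiPrime_val_of_eq {d : (two I hI).Dart} (hd : d.color = Fin.last (r + 2)) :
    (xiPrime hK S φ hp h0 s hs).val d =
      onWhite ℓ (K.yPerm hK S φ) (shifts_yPerm hK S φ hp h0) * s :=
  if_pos hd

theorem xiPrime_val_of_ne {d : (two I hI).Dart} (hd : d.color ≠ Fin.last (r + 2)) :
    (xiPrime hK S φ hp h0 s hs).val d =
      onWhite ℓ (K.xiVal hK S φ I hI d) (shifts_xiVal hK S φ hp h0 d) :=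
  if_neg hd

/-- Conjugated by `whiten`, the voltage of a dart of color `i` acts on flags as the flag
permutation of color `i`. -/
theorem xiPrime_val_fst (hn : Fin.last (r + 2) ∉ I) (d : (two I hI).Dart)
    (z : K.WhiteFlag I hI p × ZMod (2 * ℓ)) :
    ((((xiPrime hK S φ hp h0 s hs).val d).unop z).1.1 : K.hat.V) =
      whiten d.src (K.flagStep hK S φ d.color (whiten d.tgt z.1.1)) := by
  obtain ⟨v, i⟩ := d
  change Bool at v
  have htgt : i ∉ I → (Dart.tgt (X := two I hI) ⟨v, i⟩ : Bool) = !v := fun h => if_neg h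
  have hcomm := fun w => congrArg (fun g => g.unop w) (K.rhoTilde_comm hK S φ)
  by_cases hi : i = Fin.last (r + 2)
  · subst hi
    rw [xiPrime_val_of_eq hK S φ hp h0 hs rfl, htgt hn]
    unfold flagStep
    rw [dif_neg (by simp)]
    change ((s.unop _).1.1 : K.hat.V) = _
    rw [hs.fst_apply]
    change K.hat.adj 0 ((K.rhoTilde hK S φ).unop z.1.1) = _
    cases v
    · rfl
    · exact hcomm z.1.1
  · have hi' : (i : ℕ) < r + 2 := Fin.val_lt_last hi
    rw [xiPrime_val_of_ne hK S φ hp h0 hs hi, K.flagStep_of_lt hK S φ hi']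
    change (K.xiVal hK S φ I hI ⟨v, i⟩).unop z.1.1 = _
    unfold xiVal
    by_cases hi0 : i = 0
    · subst hi0
      rw [if_pos rfl, htgt h0]
      cases v
      · exact (K.hat.adj_adj 0 _).symm
      · exact (K.hat.adj_adj 0 _).symm
    · by_cases hiI : i ∈ I <;> cases v <;> simp [hi0, hi', hiI, Dart.tgt, whiten] <;> rfl

theorem xiPrime_val_snd {d : (two I hI).Dart} (hd : (d.color : ℕ) < r + 2)
    (z : K.WhiteFlag I hI p × ZMod (2 * ℓ)) :
    (((xiPrime hK S φ hp h0 s hs).val d).unop z).2 = z.2 := by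
  have : d.color ≠ Fin.last (r + 2) := fun h => by simp [h] at hd
  rw [xiPrime_val_of_ne hK S φ hp h0 hs this]
  rfl

theorem xiPrime_listVoltage_fst (hn : Fin.last (r + 2) ∉ I) {a b : Bool}
    {W : List (two I hI).Dart} (hW : IsPath (X := two I hI) b a W)
    (z : K.WhiteFlag I hI p × ZMod (2 * ℓ)) :
    ((((xiPrime hK S φ hp h0 s hs).listVoltage W).unop z).1.1 : K.hat.V) =
      whiten a (K.flagSteps hK S φ (W.map Dart.color) (whiten b z.1.1)) := by
  induction W generalizing a with
  | nil =>
    obtain rfl : a = b := hW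
    exact (whiten_whiten a _).symm
  | cons d W ih =>
    obtain ⟨rfl, hW⟩ := hW
    change ((((xiPrime hK S φ hp h0 s hs).val d).unop
      (((xiPrime hK S φ hp h0 s hs).listVoltage W).unop z)).1.1 : K.hat.V) = _
    rw [xiPrime_val_fst hK S φ hp h0 hs hn, ih hW, whiten_whiten]
    rfl

theorem xiPrime_listVoltage_snd {W : List (two I hI).Dart}
    (hW : ∀ d ∈ W, (d.color : ℕ) < r + 2) (z : K.WhiteFlag I hI p × ZMod (2 * ℓ)) :
    (((xiPrime hK S φ hp h0 s hs).listVoltage W).unop z).2 = z.2 := by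
  induction W with
  | nil => rfl
  | cons d W ih =>
    change (((xiPrime hK S φ hp h0 s hs).val d).unop
      (((xiPrime hK S φ hp h0 s hs).listVoltage W).unop z)).2 = _
    rw [xiPrime_val_snd hK S φ hp h0 hs (hW d List.mem_cons_self),
      ih fun e he => hW e (List.mem_cons_of_mem d he)]

/-- A walk in `2̂^K` from a flag over `b` to a flag over `a` projects, read backwards, to a path from
`a` to `b`. -/
theorem exists_path_of_flagSteps (hp : IsCovering K.hat (two I hI) p) {L : List (Fin (r + 3))}
    (hL : ∀ i ∈ L, (i : ℕ) < r + 2) {a b : (two I hI).V} {v : K.hat.V} (hb : p v = b)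
    (ha : p (K.flagSteps hK S φ L v) = a) :
    ∃ W : (two I hI).Path a b, W.1.map Dart.color = L := by
  induction L generalizing a with
  | nil => exact ⟨⟨[], ha.symm.trans hb⟩, rfl⟩
  | cons i L ih =>
    obtain ⟨⟨W, hW⟩, hWL⟩ := ih (fun j hj => hL j (List.mem_cons_of_mem i hj)) rfl
    have hi := hL i List.mem_cons_self
    refine ⟨⟨⟨a, i⟩ :: W, rfl, ?_⟩, congrArg (i :: ·) hWL⟩
    have e : (two I hI).adj i a = p (K.flagSteps hK S φ L v) := by
      rw [← ha, flagSteps_cons, K.flagStep_of_lt hK S φ hi, hp ⟨i, hi⟩]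
      exact (two I hI).adj_adj i _
    change IsPath (X := two I hI) b ((two I hI).adj i a) W
    rw [e]
    exact hW

end Voltages

/-- The intersection property for the voltages of paths in `2^{n+1}_I`. -/
theorem xiPrime_image_pathsWithColors_inter {r : ℕ} {K : Premaniplex (r + 1 + 1)}
    (hK : K.IsRegular) {S : Set K.Facet} {φ : K.V} {I : Set (Fin (r + 1 + 3))}
    {hI : I ≠ Set.univ} {p : K.hat.V → (two I hI).V} (hS : K.NotCovered S)
    (hK' : K.HasIntersectionProperty) {q : K.V → ZMod 4 × Bool} (hq : K.IsSquareProjection q)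
    (hp : IsCovering K.hat (two I hI) p) (h0 : (0 : Fin (r + 1 + 3)) ∉ I)
    (hn : Fin.last (r + 1 + 2) ∉ I) {ℓ : ℕ} {s : VoltageGroup p ℓ}
    (hs : IsSheetInvolution hK S φ hp h0 s) {k m : ℕ} (hk : 1 < k) (a b : (two I hI).V) :
    (xiPrime hK S φ hp h0 s hs).onPaths ''
        (two I hI).pathsWithColors (colorInterval (r + 1 + 3) 0 m) a b ∩
      (xiPrime hK S φ hp h0 s hs).onPaths ''
        (two I hI).pathsWithColors (colorInterval (r + 1 + 3) k (r + 1 + 2)) a b =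
    (xiPrime hK S φ hp h0 s hs).onPaths ''
      (two I hI).pathsWithColors (colorInterval (r + 1 + 3) k m) a b := by
  set ξ := xiPrime hK S φ hp h0 s hs with hξ
  have hmono : ∀ {J J' : Set (Fin (r + 1 + 3))}, J ⊆ J' →
      ξ.onPaths '' (two I hI).pathsWithColors J a b ⊆
        ξ.onPaths '' (two I hI).pathsWithColors J' a b := by
    intro J J' hJ
    refine Set.image_mono ?_
    rintro _ ⟨W, hW, rfl⟩
    exact ⟨W, fun d hd => hJ (hW d hd), rfl⟩
  apply Set.Subset.antisymm
  · by_cases hm : r + 1 + 2 ≤ m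
    · exact Set.inter_subset_right.trans (hmono fun i hi => ⟨hi.1, hi.2.trans hm⟩)
    rintro g ⟨⟨_, ⟨W₁, hW₁, rfl⟩, e₁⟩, ⟨_, ⟨W₂, hW₂, rfl⟩, e₂⟩⟩
    change Bool at a b
    change ξ.listVoltage W₁.1 = g at e₁
    change ξ.listVoltage W₂.1 = g at e₂
    have hc₁ : ∀ i ∈ W₁.1.map Dart.color, (i : ℕ) < r + 1 + 2 ∧ (i : ℕ) ≤ m := by
      intro i hi
      obtain ⟨d, hd, rfl⟩ := List.mem_map.mp hi
      have := (hW₁ d hd).2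
      exact ⟨by omega, this⟩
    have hc₂ : ∀ i ∈ W₂.1.map Dart.color, k ≤ (i : ℕ) := by
      intro i hi
      obtain ⟨d, hd, rfl⟩ := List.mem_map.mp hi
      exact (hW₂ d hd).1
    have hP : ∀ v, p v = b ∨ p (K.hat.adj 0 v) = b := by
      intro v
      rw [color_adj_zero hp h0]
      have key : ∀ c d : Bool, d = c ∨ (!d) = c := by decide
      exact key b (p v)
    have hagree : ∀ v, p v = b → K.flagSteps hK S φ (W₁.1.map Dart.color) v =
        K.flagSteps hK S φ (W₂.1.map Dart.color) v := by
      intro v hv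
      let z : K.WhiteFlag I hI p × ZMod (2 * ℓ) := (⟨whiten b v, color_whiten hp h0 hv⟩, 0)
      have h1 := xiPrime_listVoltage_fst hK S φ hp h0 hs hn W₁.2 z
      have h2 := xiPrime_listVoltage_fst hK S φ hp h0 hs hn W₂.2 z
      rw [← hξ, e₁] at h1
      rw [← hξ, e₂] at h2
      simp only [z, whiten_whiten] at h1 h2
      simpa only [whiten_whiten] using congrArg (whiten a) (h1.symm.trans h2)
    obtain ⟨L₃, hL₃, h₃⟩ := exists_flagSteps_eq_of_flagSteps_eq hK hS hq hK' hk hc₁ hc₂ hP hagree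
    -- The first path shows that `L₃` leads from flags over `b` to flags over `a`.
    obtain ⟨v, hv⟩ : ∃ v, p v = b := (hP (φ, 0)).elim (fun h => ⟨_, h⟩) (fun h => ⟨_, h⟩)
    have ha : p (K.flagSteps hK S φ L₃ v) = a := by
      rw [h₃]
      let z : K.WhiteFlag I hI p × ZMod (2 * ℓ) := (⟨whiten b v, color_whiten hp h0 hv⟩, 0)
      have h1 := xiPrime_listVoltage_fst hK S φ hp h0 hs hn W₁.2 z
      have h2 : p (whiten a (K.flagSteps hK S φ (W₁.1.map Dart.color) v)) = true := by
        simp only [z, whiten_whiten] at h1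
        rw [← h1]
        exact (((xiPrime hK S φ hp h0 s hs).listVoltage W₁.1).unop z).1.2
      cases a
      · have h4 := (color_adj_zero hp h0 _).symm.trans h2
        exact Bool.not_eq_true_eq_eq_false _ ▸ h4
      · exact h2
    obtain ⟨W₃, hW₃⟩ := exists_path_of_flagSteps hK S φ hp (fun i hi => (hL₃ i hi).1) hv ha
    have hcol : ∀ d ∈ W₃.1, d.color ∈ L₃ := fun d hd => hW₃ ▸ List.mem_map_of_mem hd
    refine ⟨_, ⟨W₃, fun d hd => (hL₃ _ (hcol d hd)).2, rfl⟩, ?_⟩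
    change ξ.listVoltage W₃.1 = g
    rw [← e₁]
    apply MulOpposite.unop_injective
    apply Equiv.ext
    intro z
    refine Prod.ext (Subtype.ext ?_) ?_
    · rw [hξ, xiPrime_listVoltage_fst hK S φ hp h0 hs hn W₃.2,
        xiPrime_listVoltage_fst hK S φ hp h0 hs hn W₁.2, hW₃, h₃]
    · rw [hξ, xiPrime_listVoltage_snd hK S φ hp h0 hs fun d hd => (hL₃ _ (hcol d hd)).1,
        xiPrime_listVoltage_snd hK S φ hp h0 hs
          fun d hd => (hc₁ _ (List.mem_map_of_mem hd)).1]
  · exact Set.subset_inter (hmono fun i hi => ⟨Nat.zero_le _, hi.2⟩)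
      (hmono fun i hi => ⟨hi.1, by omega⟩)

end Premaniplex

open Premaniplex in
theorem corollary5p5
    -- the rank is `n = t + 4`, so that `fam (t + 1)` is `M_(n-1)` and its `hat` is `M_n`
    (t : ℕ)
    -- `S₃`: facets of `M_3`, not invariant under any non-trivial automorphism and not contained
    -- in the union of the closures of two vertices
    (S₃ : Set (fam 1).Facet)
    (hS₃ : ∀ γ : (fam 1).Aut, (fam 1).faceMap (Fin.last 2) γ '' S₃ = S₃ → γ = 1)
    (hS₃' : ∀ u v : (fam 1).Face 0, ¬ S₃ ⊆ (fam 1).closure u ∪ (fam 1).closure v)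
    -- `X = 2^{n+1}_I`, with links of colors `0` and `n`
    (I : Set (Fin (t + 5))) (hI : I ≠ Set.univ) (h0 : 0 ∉ I) (hn : Fin.last (t + 4) ∉ I)
    -- the base flag `(φ, 0)` of the base facet of `M_n`
    (φ : (fam (t + 1)).V)
    -- the coloring of the flags of `M_n`
    (p : (fam (t + 1)).hat.V → (two I hI).V) (hp : IsCovering (fam (t + 1)).hat (two I hI) p)
    (ℓ : ℕ) (hℓ : 0 < ℓ) (s : VoltageGroup p ℓ)
    (hs : IsSheetInvolution (fam_isRegular (t + 1)) (famSet S₃ t) φ hp h0 s)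
    (ξ' : (two I hI).Voltage (VoltageGroup p ℓ))
    (hξ' : ξ' = xiPrime (fam_isRegular (t + 1)) (famSet S₃ t) φ hp h0 s hs)
    (k m : ℕ) (hk : 1 < k) (hm : m ≤ t + 4) (a b : (two I hI).V) :
    ξ'.onPaths '' (two I hI).pathsWithColors (colorInterval (t + 5) 0 m) a b ∩
        ξ'.onPaths '' (two I hI).pathsWithColors (colorInterval (t + 5) k (t + 4)) a b =
      ξ'.onPaths '' (two I hI).pathsWithColors (colorInterval (t + 5) k m) a b := by
  subst hξ'
  obtain ⟨q, hq⟩ := fam_exists_isSquareProjection (t + 1)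
  exact xiPrime_image_pathsWithColors_inter (fam_isRegular (t + 1)) (famSet_notCovered hS₃' t)
    (fam_hasIntersectionProperty (t + 1)) hq hp h0 hn hs hk a b
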